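/- Let $m\in\mathbb{N}$, $m\ge 1$. (In the screen problem in $\mathbb{R}^n$ one has $m=n-1$, and the hyperplane $\Gamma_\infty=\mathbb{R}^{n-1}\times\{0\}$ is identified with $\mathbb{R}^{m}$.) **Sobolev spaces.** For $s\in\mathbb{R}$ let $H^s=H^s(\mathbb{R}^m)$ be the complex Hilbert space of tempered distributions $u$ on $\mathbb{R}^m$ whose Fourier transform $\hat u$ is a locally integrable function with $\|u\|_{H^s}^2:=\int_{\mathbb{R}^m}(1+|\xi|^2)^s|\hat u(\xi)|^2\,d\xi<\infty$, where $\hat u(\xi)=(2\pi)^{-m/2}\int e^{-i\xi\cdot x}u(x)\,dx$ for $u\in C_0^\infty(\mathbb{R}^m)$. For a closed set $F\subset\mathbb{R}^m$ let $H^s_F:=\{u\in H^s:\operatorname{supp}u\subset F\}$. **Mosco convergence.** Closed subspaces $W_j$ ($j\in\mathbb{N}$) of a Hilbert space $H$ Mosco-converge to a closed subspace $W$ if (i) for every $w\in W$ there are $w_j\in W_j$ with $\|w_j-w\|_H\to0$; and (ii) whenever $(W_{j_i})_{i}$ is a subsequence, $w_i\in W_{j_i}$ and $w_i\rightharpoonup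 w$ weakly in $H$, then $w\in W$. **Meshes.** A pre-convex mesh on a bounded open set $\Omega\subset\mathbb{R}^m$ is a finite family of non-empty open sets $T_1,\dots,T_N\subset\Omega$ whose convex hulls are pairwise disjoint, whose boundaries $\partial T_l$ have zero $m$-dimensional Lebesgue measure, and for which $\Omega$ is the interior of $\bigcup_{l=1}^N\overline{T_l}$. Its mesh size is $\max_l\operatorname{diam}(T_l)$. **Theorem.** Let $\Gamma\subset\mathbb{R}^m$ be non-empty and compact, and for $\epsilon>0$ let $\Gamma(\epsilon):=\{x\in\mathbb{R}^m:\operatorname{dist}(x,\Gamma)<\epsilon\}$. Let $\Gamma_j$, $j\in\mathbb{N}$, be bounded open sets with $\Gamma(\epsilon_j)\subset\Gamma_j\subset\Gamma(\eta_j)$, where $0<\epsilon_j<\eta_j$ and $\eta_j\to0$ as $j\to\infty$. For each $j$ let $M_j$ be a pre-convex mesh on $\Gamma_j$ of mesh size $h_j$, and let $V_j^h$ be the space of piecewise constant functions on $M_j$, i.e. of the $u\in L^2(\Gamma_j)$ that are constant on each element of $M_j$, extended by zero to $\mathbb{R}^m$ and regarded as elements of $H^{-1/2}$. Let $t\in[-1/2,0]$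 be such that $H^t_\Gamma$ is dense in $H^{-1/2}_\Gamma$ (which is always true for $t=-1/2$). If $h_j=o(\epsilon_j^{-2t})$ as $j\to\infty$, then $V_j^h$ and $H^{-1/2}_\Gamma$ are closed subspaces of $H^{-1/2}$ and $V_j^h$ Mosco-converges to $H^{-1/2}_\Gamma$ (that is, BEM convergence holds). -/

import Mathlib

open MeasureTheory Filter Topology Asymptotics
open scoped FourierTransform SchwartzMap

noncomputable section

namespace ScreenBEM

/-- The Euclidean space `ℝᵐ`, in which the hyperplane of the screens is identified. -/
abbrev Eucl (m : ℕ) : Type := EuclideanSpace ℝ (Fin m)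

/-! ### The Sobolev spaces `Hˢ(ℝᵐ)` -/

/-- The weight `(1 + |2πξ|²)^(s/2)`. Mathlib's Fourier transform is
`𝓕 u ξ = ∫ exp (-2πi ξ·x) u x dx`, so that the unitary transform with kernel
`(2π)^(-m/2) exp (-i ω·x)` is `û ω = (2π)^(-m/2) 𝓕 u (ω / 2π)`, and
`∫ (1 + |ω|²)^s |û ω|² dω = ∫ (1 + |2πξ|²)^s |𝓕 u ξ|² dξ`. -/
def sobolevWeight (m : ℕ) (s : ℝ) (ξ : Eucl m) : ℂ :=
  (((1 + ‖(2 * Real.pi) • ξ‖ ^ 2) ^ (s / 2) : ℝ) : ℂ)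

theorem sobolevWeight_hasTemperateGrowth (m : ℕ) (s : ℝ) :
    (sobolevWeight m s).HasTemperateGrowth := by
  have h1 : (fun x : Eucl m => (1 + ‖x‖ ^ 2) ^ (s / 2)).HasTemperateGrowth := by fun_prop
  have h2 : (fun ξ : Eucl m => (2 * Real.pi) • ξ).HasTemperateGrowth := by fun_prop
  exact Function.Complex.hasTemperateGrowth_ofReal.comp (h1.comp h2)

theorem sobolevWeight_mul_neg (m : ℕ) (s : ℝ) :
    sobolevWeight m s * sobolevWeight m (-s) = fun _ => 1 := by
  funext ξ
  simp only [Pi.mul_apply, sobolevWeight]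
  rw [← Complex.ofReal_mul, ← Real.rpow_add (by positivity)]
  simp [neg_div]

/-- The weighted Fourier transform `(1 + |2πξ|²)^(s/2) 𝓕 u` of a tempered distribution. -/
def weightedFourier (m : ℕ) (s : ℝ) (u : 𝓢'(Eucl m, ℂ)) : 𝓢'(Eucl m, ℂ) :=
  TemperedDistribution.smulLeftCLM ℂ (sobolevWeight m s) (𝓕 u)

theorem toTemperedDistribution_injective (m : ℕ) :
    Function.Injective
      (Lp.toTemperedDistribution : Lp ℂ 2 (volume : Measure (Eucl m)) → 𝓢'(Eucl m, ℂ)) := by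
  have h := LinearMap.ker_eq_bot.mp
    (Lp.ker_toTemperedDistributionCLM_eq_bot (E := Eucl m) (F := ℂ) (μ := volume) (p := 2))
  exact h

/-- The tempered distributions `u` whose weighted Fourier transform is an `L²` function. -/
def sobolevSubmodule (m : ℕ) (s : ℝ) : Submodule ℂ 𝓢'(Eucl m, ℂ) where
  carrier := {u | ∃ g : Lp ℂ 2 (volume : Measure (Eucl m)),
    weightedFourier m s u = Lp.toTemperedDistribution g}
  zero_mem' := ⟨0, by
    rw [← Lp.toTemperedDistributionCLM_apply, map_zero, weightedFourier,
      FourierTransform.fourier_zero, map_zero]⟩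
  add_mem' := by
    rintro u v ⟨f, hf⟩ ⟨g, hg⟩
    refine ⟨f + g, ?_⟩
    rw [← Lp.toTemperedDistributionCLM_apply, map_add, Lp.toTemperedDistributionCLM_apply,
      Lp.toTemperedDistributionCLM_apply, ← hf, ← hg]
    simp only [weightedFourier, FourierTransform.fourier_add, map_add]
  smul_mem' := by
    rintro c u ⟨f, hf⟩
    refine ⟨c • f, ?_⟩
    rw [← Lp.toTemperedDistributionCLM_apply, map_smul, Lp.toTemperedDistributionCLM_apply, ← hf]
    simp only [weightedFourier, FourierTransform.fourier_smul, map_smul]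

/-- The Sobolev space `Hˢ(ℝᵐ)`, a space of tempered distributions. (It is a separate type so
that it carries the topology of its norm, not the one induced by the tempered distributions.) -/
def Sobolev (m : ℕ) (s : ℝ) : Type := sobolevSubmodule m s

instance (m : ℕ) (s : ℝ) : AddCommGroup (Sobolev m s) :=
  inferInstanceAs (AddCommGroup (sobolevSubmodule m s))

instance (m : ℕ) (s : ℝ) : Module ℂ (Sobolev m s) :=
  inferInstanceAs (Module ℂ (sobolevSubmodule m s))

/-- An element of `Hˢ(ℝᵐ)` as a tempered distribution. -/
def Sobolev.toDistr (m : ℕ) (s : ℝ) : Sobolev m s →ₗ[ℂ] 𝓢'(Eucl m, ℂ) :=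
  (sobolevSubmodule m s).subtype

/-- The `L²` function `(1 + |2πξ|²)^(s/2) 𝓕 u` of an element `u` of `Hˢ(ℝᵐ)`. -/
def Sobolev.symbolFun {m : ℕ} {s : ℝ} (u : Sobolev m s) : Lp ℂ 2 (volume : Measure (Eucl m)) :=
  Classical.choose u.2

theorem Sobolev.symbolFun_spec {m : ℕ} {s : ℝ} (u : Sobolev m s) :
    weightedFourier m s (Sobolev.toDistr m s u) = Lp.toTemperedDistribution u.symbolFun :=
  Classical.choose_spec u.2

theorem Sobolev.symbolFun_unique {m : ℕ} {s : ℝ} (u : Sobolev m s)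
    (g : Lp ℂ 2 (volume : Measure (Eucl m)))
    (h : weightedFourier m s (Sobolev.toDistr m s u) = Lp.toTemperedDistribution g) :
    u.symbolFun = g :=
  toTemperedDistribution_injective m (u.symbolFun_spec.symm.trans h)

/-- `u ↦ (1 + |2πξ|²)^(s/2) 𝓕 u` as a linear map from `Hˢ(ℝᵐ)` to `L²(ℝᵐ)`. -/
def Sobolev.symbol (m : ℕ) (s : ℝ) :
    Sobolev m s →ₗ[ℂ] Lp ℂ 2 (volume : Measure (Eucl m)) where
  toFun := Sobolev.symbolFun
  map_add' u v := by
    apply Sobolev.symbolFun_unique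
    rw [← Lp.toTemperedDistributionCLM_apply, map_add, map_add, Lp.toTemperedDistributionCLM_apply,
      Lp.toTemperedDistributionCLM_apply, ← u.symbolFun_spec, ← v.symbolFun_spec]
    simp only [weightedFourier, FourierTransform.fourier_add, map_add]
  map_smul' c u := by
    apply Sobolev.symbolFun_unique
    rw [RingHom.id_apply, ← Lp.toTemperedDistributionCLM_apply, map_smul, map_smul,
      Lp.toTemperedDistributionCLM_apply, ← u.symbolFun_spec]
    simp only [weightedFourier, FourierTransform.fourier_smul, map_smul]

theorem weightedFourier_inverse (m : ℕ) (s : ℝ) (w : 𝓢'(Eucl m, ℂ)) :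
    weightedFourier m s
      (𝓕⁻ (TemperedDistribution.smulLeftCLM ℂ (sobolevWeight m (-s)) w)) = w := by
  rw [weightedFourier, FourierTransform.fourier_fourierInv_eq,
    TemperedDistribution.smulLeftCLM_smulLeftCLM_apply (sobolevWeight_hasTemperateGrowth m (-s))
      (sobolevWeight_hasTemperateGrowth m s)]
  rw [mul_comm, sobolevWeight_mul_neg]
  simp

theorem weightedFourier_inverse' (m : ℕ) (s : ℝ) (u : 𝓢'(Eucl m, ℂ)) :
    𝓕⁻ (TemperedDistribution.smulLeftCLM ℂ (sobolevWeight m (-s)) (weightedFourier m s u))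
      = u := by
  rw [weightedFourier,
    TemperedDistribution.smulLeftCLM_smulLeftCLM_apply (sobolevWeight_hasTemperateGrowth m s)
      (sobolevWeight_hasTemperateGrowth m (-s))]
  rw [sobolevWeight_mul_neg]
  simp

theorem Sobolev.symbol_injective (m : ℕ) (s : ℝ) : Function.Injective (Sobolev.symbol m s) := by
  intro u v h
  have h1 : weightedFourier m s (Sobolev.toDistr m s u) =
      weightedFourier m s (Sobolev.toDistr m s v) := by
    rw [u.symbolFun_spec, v.symbolFun_spec]
    exact congrArg _ h
  have h2 := congrArg (fun w => 𝓕⁻ (TemperedDistribution.smulLeftCLM ℂ (sobolevWeight m (-s)) w)) h1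
  simp only [weightedFourier_inverse'] at h2
  exact Subtype.ext h2

theorem Sobolev.symbol_surjective (m : ℕ) (s : ℝ) :
    Function.Surjective (Sobolev.symbol m s) := by
  intro g
  have h := weightedFourier_inverse m s (Lp.toTemperedDistribution g)
  exact ⟨⟨_, g, h⟩, Sobolev.symbolFun_unique _ g h⟩

/-- `‖u‖² = ∫ (1 + |2πξ|²)^s |𝓕 u ξ|² dξ`. -/
instance (m : ℕ) (s : ℝ) : NormedAddCommGroup (Sobolev m s) :=
  NormedAddCommGroup.induced (Sobolev m s) (Lp ℂ 2 (volume : Measure (Eucl m)))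
    (Sobolev.symbol m s) (Sobolev.symbol_injective m s)

theorem Sobolev.norm_eq {m : ℕ} {s : ℝ} (u : Sobolev m s) : ‖u‖ = ‖Sobolev.symbol m s u‖ := rfl

/-- `⟪u, v⟫ = ∫ (1 + |2πξ|²)^s conj (𝓕 u ξ) 𝓕 v ξ dξ`. -/
instance (m : ℕ) (s : ℝ) : InnerProductSpace ℂ (Sobolev m s) where
  norm_smul_le c u := by
    rw [Sobolev.norm_eq, Sobolev.norm_eq, map_smul]
    exact norm_smul_le c _
  inner u v := inner ℂ (Sobolev.symbol m s u) (Sobolev.symbol m s v)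
  norm_sq_eq_re_inner u := norm_sq_eq_re_inner (𝕜 := ℂ) (Sobolev.symbol m s u)
  conj_inner_symm u v := inner_conj_symm _ _
  add_left u v w := by rw [map_add, inner_add_left]
  smul_left u v c := by rw [map_smul, inner_smul_left]

/-- The linear isometric identification of `Hˢ(ℝᵐ)` with `L²(ℝᵐ)`. -/
def Sobolev.symbolEquiv (m : ℕ) (s : ℝ) :
    Sobolev m s ≃ₗᵢ[ℂ] Lp ℂ 2 (volume : Measure (Eucl m)) :=
  { LinearEquiv.ofBijective (Sobolev.symbol m s)
      ⟨Sobolev.symbol_injective m s, Sobolev.symbol_surjective m s⟩ with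
    norm_map' := fun _ => rfl }

instance (m : ℕ) (s : ℝ) : CompleteSpace (Sobolev m s) :=
  (Sobolev.symbolEquiv m s).toIsometryEquiv.completeSpace

/-- The subspace `Hˢ_F` of the elements of `Hˢ(ℝᵐ)` supported in the (closed) set `F`. -/
def supportedIn (m : ℕ) (s : ℝ) (F : Set (Eucl m)) : Submodule ℂ (Sobolev m s) where
  carrier := {u | Distribution.dsupport (Sobolev.toDistr m s u) ⊆ F}
  zero_mem' := by
    intro x hx
    refine absurd hx ((Distribution.notMem_dsupport_iff x).2
      ⟨Set.univ, fun φ _ => ?_, isOpen_univ, Set.mem_univ x⟩)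
    rw [map_zero]
    rfl
  add_mem' := by
    intro u v hu hv x hx
    by_contra hxF
    obtain ⟨A, hA, hAo, hxA⟩ :=
      (Distribution.notMem_dsupport_iff x).1 (fun h => hxF (hu h))
    obtain ⟨B, hB, hBo, hxB⟩ :=
      (Distribution.notMem_dsupport_iff x).1 (fun h => hxF (hv h))
    refine (Distribution.notMem_dsupport_iff x).2
      ⟨A ∩ B, fun φ hφ => ?_, hAo.inter hBo, hxA, hxB⟩ hx
    have h1 := hA φ (hφ.trans Set.inter_subset_left)
    have h2 := hB φ (hφ.trans Set.inter_subset_right)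
    rw [map_add]
    change Sobolev.toDistr m s u φ + Sobolev.toDistr m s v φ = 0
    rw [h1, h2, add_zero]
  smul_mem' := by
    intro c u hu x hx
    by_contra hxF
    obtain ⟨A, hA, hAo, hxA⟩ :=
      (Distribution.notMem_dsupport_iff x).1 (fun h => hxF (hu h))
    refine (Distribution.notMem_dsupport_iff x).2 ⟨A, fun φ hφ => ?_, hAo, hxA⟩ hx
    rw [map_smul]
    change c • Sobolev.toDistr m s u φ = 0
    rw [hA φ hφ, smul_zero]

/-- `Hᵗ_F` is dense in `Hˢ_F` (for `s ≤ t`): every element of `Hˢ_F` is a limit, in the norm of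
`Hˢ(ℝᵐ)`, of elements of `Hˢ(ℝᵐ)` which, as distributions, belong to `Hᵗ_F`. -/
def SupportedDense (m : ℕ) (t s : ℝ) (F : Set (Eucl m)) : Prop :=
  ∀ u ∈ supportedIn m s F,
    u ∈ closure {v : Sobolev m s |
      ∃ w ∈ supportedIn m t F, Sobolev.toDistr m t w = Sobolev.toDistr m s v}

/-! ### Mosco convergence -/

/-- Mosco convergence of a sequence of closed subspaces `W j` of a Hilbert space to a closed
subspace `V`. -/
structure MoscoConverges {H : Type*} [NormedAddCommGroup H] [InnerProductSpace ℂ H]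
    [CompleteSpace H] (W : ℕ → Submodule ℂ H) (V : Submodule ℂ H) : Prop where
  isClosed_seq : ∀ j, IsClosed (W j : Set H)
  isClosed_limit : IsClosed (V : Set H)
  /-- Every element of the limit is a strong limit of elements of the `W j`. -/
  strong_approx : ∀ v ∈ V, ∃ w : ℕ → H, (∀ j, w j ∈ W j) ∧
    Tendsto (fun j => ‖w j - v‖) atTop (𝓝 0)
  /-- Weak limits of elements of a subsequence of `W` belong to the limit. -/
  weak_limit : ∀ k : ℕ → ℕ, StrictMono k → ∀ w : ℕ → H, (∀ i, w i ∈ W (k i)) →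
    ∀ v : H, (∀ l : H →L[ℂ] ℂ, Tendsto (fun i => l (w i)) atTop (𝓝 (l v))) → v ∈ V

/-! ### Meshes and piecewise constant functions -/

/-- A pre-convex mesh on the open set `Ω`. -/
structure PreConvexMesh {m : ℕ} (Ω : Set (Eucl m)) where
  /-- The number of elements. -/
  N : ℕ
  /-- The elements. -/
  T : Fin N → Set (Eucl m)
  isOpen_T : ∀ l, IsOpen (T l)
  nonempty_T : ∀ l, (T l).Nonempty
  T_subset : ∀ l, T l ⊆ Ω
  disjoint_convexHull : ∀ l l', l ≠ l' →
    Disjoint (convexHull ℝ (T l)) (convexHull ℝ (T l'))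
  volume_frontier : ∀ l, volume (frontier (T l)) = 0
  eq_interior : Ω = interior (⋃ l, closure (T l))

/-- The mesh size, the largest diameter of an element. -/
def PreConvexMesh.meshSize {m : ℕ} {Ω : Set (Eucl m)} (M : PreConvexMesh Ω) : ℝ :=
  ⨆ l, Metric.diam (M.T l)

/-- The piecewise constant functions on a mesh on `Ω`: the square integrable functions on `Ω`
that are constant on each element, extended by zero to `ℝᵐ` and regarded as elements
of `Hˢ(ℝᵐ)`. -/
def PreConvexMesh.piecewiseConst {m : ℕ} {Ω : Set (Eucl m)} (M : PreConvexMesh Ω) (s : ℝ) :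
    Submodule ℂ (Sobolev m s) where
  carrier := {u | ∃ f : Lp ℂ 2 (volume : Measure (Eucl m)),
    Sobolev.toDistr m s u = Lp.toTemperedDistribution f ∧
    (∀ᵐ x, x ∉ Ω → f x = 0) ∧
    ∀ l, ∃ c : ℂ, ∀ᵐ x, x ∈ M.T l → f x = c}
  zero_mem' := by
    refine ⟨0, ?_, ?_, fun l => ⟨0, ?_⟩⟩
    · rw [map_zero, ← Lp.toTemperedDistributionCLM_apply, map_zero]
    · exact Eventually.of_forall fun x _ => by simp
    · exact Eventually.of_forall fun x _ => by simp
  add_mem' := by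
    rintro u v ⟨f, hf, hf0, hfc⟩ ⟨g, hg, hg0, hgc⟩
    refine ⟨f + g, ?_, ?_, fun l => ?_⟩
    · rw [map_add, hf, hg, ← Lp.toTemperedDistributionCLM_apply,
        ← Lp.toTemperedDistributionCLM_apply, ← Lp.toTemperedDistributionCLM_apply, map_add]
    · filter_upwards [Lp.coeFn_add f g, hf0, hg0] with x hx h1 h2 hxΩ
      rw [hx, Pi.add_apply, h1 hxΩ, h2 hxΩ, add_zero]
    · obtain ⟨c, hc⟩ := hfc l
      obtain ⟨d, hd⟩ := hgc l
      refine ⟨c + d, ?_⟩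
      filter_upwards [Lp.coeFn_add f g, hc, hd] with x hx h1 h2 hxT
      rw [hx, Pi.add_apply, h1 hxT, h2 hxT]
  smul_mem' := by
    rintro a u ⟨f, hf, hf0, hfc⟩
    refine ⟨a • f, ?_, ?_, fun l => ?_⟩
    · rw [map_smul, hf, ← Lp.toTemperedDistributionCLM_apply,
        ← Lp.toTemperedDistributionCLM_apply, map_smul]
    · filter_upwards [Lp.coeFn_smul a f, hf0] with x hx h1 hxΩ
      rw [hx, Pi.smul_apply, h1 hxΩ, smul_zero]
    · obtain ⟨c, hc⟩ := hfc l
      refine ⟨a • c, ?_⟩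
      filter_upwards [Lp.coeFn_smul a f, hc] with x hx h1 hxT
      rw [hx, Pi.smul_apply, h1 hxT]

end ScreenBEM

end

open ScreenBEM

/-!
Mosco convergence has a strong half and a weak half, and the spaces have to be closed.

*Strong approximation.* The elements of `H^(-1/2)` that the piecewise constants approximate form a
closed set (`tendsto_infDist_of_mem_closure`), so by density it is enough to approximate `v` in
`Hᵗ_Γ`. There are two steps. Mollifying `v` at scale `ε j` gives `v_j ∈ L²` that converges to `v` in `H^(-1/2)`,
vanishes outside the `ε j`-neighbourhood of `Γ`, hence outside `Γ_j`
(`IsMollifierSymbol.mollify_ae_eq_zero`), and satisfies `‖v_j‖_{L²} ≤ C (ε j)ᵗ`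
(`exists_norm_mollify_le`). The orthogonal projection of `v_j` in `L²` onto the piecewise constants
then has an error in `H^(-1/2)` with square at most `2^(m/2) h_j ‖v_j‖²`
(`PreConvexMesh.exists_mem_piecewiseConst_norm_sub_sq_le`), which is at most a constant times
`h_j (ε j)^(2t) → 0`.

The projection estimate is a duality argument. Let `g` be the error of the projection in `L²`, and
`φ` the function with `𝓕 φ = (1 + |2πξ|²)^(-1/2) 𝓕 g`. Then `‖g‖²_{H^(-1/2)}` is the pairing of `g`
and `φ`, and `‖∇φ‖_{L²} ≤ ‖g‖_{L²}`. As `g` is orthogonal to the piecewise constants, `φ` may be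
replaced by its difference to one of them, and this is of order `h ‖∇φ‖_{L²}` by the Poincaré
inequality on the convex hulls of the elements (`exists_setLIntegral_enorm_sub_sq_le`). The
constant of that inequality depends on the dimension only, and the hulls are disjoint, so the
bounds for the elements add up whatever the shape and the number of the elements.

*Weak limits.* Testing against a fixed Schwartz function is a continuous functional on `H^(-1/2)`,
and the support of a test function off `Γ` does not meet `Γ_j` once `η j` is small
(`mem_supportedIn_of_weak_limit`). That such test functions detect the support, and that
`H^(-1/2)_Γ` is closed, is the locality of distributions (`mem_supportedIn_iff`).

The spaces of piecewise constants are closed because they are finite-dimensional.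
-/

noncomputable section

namespace ScreenBEM

open scoped BoundedContinuousFunction

/-! ### Multiplication operators on `L²` and the embedding of `L²` into `Hˢ` -/

theorem memLp_bounded_mul {m : ℕ} (a : Eucl m →ᵇ ℂ)
    (f : Lp ℂ 2 (volume : Measure (Eucl m))) :
    MemLp (fun x => a x * f x) 2 (volume : Measure (Eucl m)) :=
  (Lp.memLp f).of_le_mul (c := ‖a‖)
    (a.continuous.aestronglyMeasurable.mul (Lp.aestronglyMeasurable f))
    (Eventually.of_forall fun x => by
      rw [norm_mul]
      exact mul_le_mul_of_nonneg_right (a.norm_coe_le_norm x) (norm_nonneg _))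

/-- Multiplication of an `L²` function by a bounded continuous function. -/
def l2Mul {m : ℕ} (a : Eucl m →ᵇ ℂ) :
    Lp ℂ 2 (volume : Measure (Eucl m)) →ₗ[ℂ] Lp ℂ 2 (volume : Measure (Eucl m)) where
  toFun f := (memLp_bounded_mul a f).toLp _
  map_add' f g := by
    ext1
    filter_upwards [(memLp_bounded_mul a (f + g)).coeFn_toLp, (memLp_bounded_mul a f).coeFn_toLp,
      (memLp_bounded_mul a g).coeFn_toLp, Lp.coeFn_add f g,
      Lp.coeFn_add ((memLp_bounded_mul a f).toLp _) ((memLp_bounded_mul a g).toLp _)]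
      with x h1 h2 h3 h4 h5
    rw [h1, h5, Pi.add_apply, h2, h3, h4, Pi.add_apply, mul_add]
  map_smul' c f := by
    ext1
    filter_upwards [(memLp_bounded_mul a (c • f)).coeFn_toLp, (memLp_bounded_mul a f).coeFn_toLp,
      Lp.coeFn_smul c f, Lp.coeFn_smul c ((memLp_bounded_mul a f).toLp _)]
      with x h1 h2 h3 h4
    rw [h1, RingHom.id_apply, h4, Pi.smul_apply, h2, h3, Pi.smul_apply, mul_smul_comm]

theorem coeFn_l2Mul {m : ℕ} (a : Eucl m →ᵇ ℂ) (f : Lp ℂ 2 (volume : Measure (Eucl m))) :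
    ∀ᵐ x, l2Mul a f x = a x * f x :=
  (memLp_bounded_mul a f).coeFn_toLp

theorem norm_l2Mul_le {m : ℕ} (a : Eucl m →ᵇ ℂ) {C : ℝ} (hC : ∀ x, ‖a x‖ ≤ C)
    (f : Lp ℂ 2 (volume : Measure (Eucl m))) : ‖l2Mul a f‖ ≤ C * ‖f‖ := by
  refine Lp.norm_le_mul_norm_of_ae_le_mul ?_
  filter_upwards [coeFn_l2Mul a f] with x hx
  rw [hx, norm_mul]
  exact mul_le_mul_of_nonneg_right (hC x) (norm_nonneg _)

theorem toTemperedDistribution_l2Mul {m : ℕ} (a : Eucl m →ᵇ ℂ)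
    (ha : (a : Eucl m → ℂ).HasTemperateGrowth) (f : Lp ℂ 2 (volume : Measure (Eucl m))) :
    Lp.toTemperedDistribution (l2Mul a f) =
      TemperedDistribution.smulLeftCLM ℂ a (Lp.toTemperedDistribution f) := by
  ext φ
  rw [Lp.toTemperedDistribution_apply, TemperedDistribution.smulLeftCLM_apply_apply,
    Lp.toTemperedDistribution_apply]
  refine integral_congr_ae ?_
  filter_upwards [coeFn_l2Mul a f] with x hx
  rw [hx, SchwartzMap.smulLeftCLM_apply_apply ha, smul_eq_mul, smul_eq_mul, smul_eq_mul]
  ring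

theorem norm_sobolevWeight {m : ℕ} (s : ℝ) (ξ : Eucl m) :
    ‖sobolevWeight m s ξ‖ = (1 + ‖(2 * Real.pi) • ξ‖ ^ 2) ^ (s / 2) := by
  rw [sobolevWeight, Complex.norm_real, Real.norm_of_nonneg (by positivity)]

theorem norm_sobolevWeight_le_one {m : ℕ} {s : ℝ} (hs : s ≤ 0) (ξ : Eucl m) :
    ‖sobolevWeight m s ξ‖ ≤ 1 := by
  rw [norm_sobolevWeight]
  exact Real.rpow_le_one_of_one_le_of_nonpos (le_add_of_nonneg_right (by positivity))
    (by linarith)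

/-- The weight `(1 + |2πξ|²)^(s/2)` as a bounded continuous function, for `s ≤ 0`. -/
def boundedWeight (m : ℕ) {s : ℝ} (hs : s ≤ 0) : Eucl m →ᵇ ℂ :=
  BoundedContinuousFunction.ofNormedAddCommGroup (sobolevWeight m s)
    (sobolevWeight_hasTemperateGrowth m s).1.continuous 1 (norm_sobolevWeight_le_one hs)

theorem boundedWeight_apply (m : ℕ) {s : ℝ} (hs : s ≤ 0) (ξ : Eucl m) :
    boundedWeight m hs ξ = sobolevWeight m s ξ := rfl

/-- The embedding of `L²(ℝᵐ)` into `Hˢ(ℝᵐ)`, for `s ≤ 0`. -/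
def Sobolev.ofL2 (m : ℕ) {s : ℝ} (hs : s ≤ 0) :
    Lp ℂ 2 (volume : Measure (Eucl m)) →ₗ[ℂ] Sobolev m s :=
  (Sobolev.symbolEquiv m s).symm.toLinearEquiv.toLinearMap ∘ₗ l2Mul (boundedWeight m hs) ∘ₗ
    (Lp.fourierTransformₗᵢ (Eucl m) ℂ).toLinearEquiv.toLinearMap

theorem Sobolev.symbol_ofL2 {m : ℕ} {s : ℝ} (hs : s ≤ 0)
    (f : Lp ℂ 2 (volume : Measure (Eucl m))) :
    Sobolev.symbol m s (Sobolev.ofL2 m hs f) = l2Mul (boundedWeight m hs) (𝓕 f) :=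
  (Sobolev.symbolEquiv m s).apply_symm_apply _

theorem weightedFourier_injective (m : ℕ) (s : ℝ) : Function.Injective (weightedFourier m s) :=
  fun u v h => by
    rw [← weightedFourier_inverse' m s u, h, weightedFourier_inverse' m s v]

theorem Sobolev.weightedFourier_toDistr {m : ℕ} {s : ℝ} (u : Sobolev m s) :
    weightedFourier m s (Sobolev.toDistr m s u) =
      Lp.toTemperedDistribution (Sobolev.symbol m s u) :=
  u.symbolFun_spec

theorem Sobolev.toDistr_ofL2 {m : ℕ} {s : ℝ} (hs : s ≤ 0)
    (f : Lp ℂ 2 (volume : Measure (Eucl m))) :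
    Sobolev.toDistr m s (Sobolev.ofL2 m hs f) = Lp.toTemperedDistribution f := by
  apply weightedFourier_injective m s
  rw [Sobolev.weightedFourier_toDistr, Sobolev.symbol_ofL2,
    toTemperedDistribution_l2Mul _ (sobolevWeight_hasTemperateGrowth m s), weightedFourier,
    Lp.fourier_toTemperedDistribution_eq]
  rfl

theorem Sobolev.toDistr_injective (m : ℕ) (s : ℝ) :
    Function.Injective (Sobolev.toDistr m s) :=
  Subtype.val_injective

/-- The pairing of the elements of `Hˢ(ℝᵐ)` with a fixed Schwartz function, as a continuous linear
functional. -/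
def Sobolev.evalCLM (m : ℕ) (s : ℝ) (φ : 𝓢(Eucl m, ℂ)) : Sobolev m s →L[ℂ] ℂ where
  toLinearMap :=
    { toFun := fun u => Sobolev.toDistr m s u φ
      map_add' := fun u v => by rw [map_add]; rfl
      map_smul' := fun c u => by rw [map_smul]; rfl }
  cont := by
    -- With `χ` the weight of order `-s` times `𝓕⁻ φ`, the pairing of `u` with `φ` is that of the
    -- symbol of `u` with `χ`.
    set χ := SchwartzMap.smulLeftCLM ℂ (sobolevWeight m (-s)) (𝓕⁻ φ) with hχ
    have h1 : ∀ u : Sobolev m s, Sobolev.toDistr m s u φ =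
        Lp.toTemperedDistributionCLM ℂ volume 2 (Sobolev.symbolEquiv m s u) χ := by
      intro u
      rw [← weightedFourier_inverse' m s (Sobolev.toDistr m s u),
        Sobolev.weightedFourier_toDistr]
      rfl
    change Continuous fun u => Sobolev.toDistr m s u φ
    simp_rw [h1]
    have h2 : Continuous fun T : 𝓢'(Eucl m, ℂ) => T χ := by fun_prop
    exact h2.comp ((Lp.toTemperedDistributionCLM ℂ volume 2).continuous.comp
      (Sobolev.symbolEquiv m s).continuous)

theorem Sobolev.evalCLM_apply {m : ℕ} {s : ℝ} (φ : 𝓢(Eucl m, ℂ)) (u : Sobolev m s) :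
    Sobolev.evalCLM m s φ u = Sobolev.toDistr m s u φ := rfl

end ScreenBEM

end

noncomputable section

namespace ScreenBEM

open scoped ContDiff Manifold
open Distribution

/-! ### Locality of tempered distributions and the spaces `Hˢ_F` -/

/-- A partition of unity shows that a tempered distribution vanishes on the test functions with
compact support off its distributional support. -/
theorem eq_zero_of_tsupport_subset_compl_dsupport {m : ℕ} (u : 𝓢'(Eucl m, ℂ))
    (φ : 𝓢(Eucl m, ℂ)) (hφ : HasCompactSupport φ) (h : tsupport φ ⊆ (dsupport u)ᶜ) :
    u φ = 0 := by
  have hloc : ∀ x : tsupport φ, ∃ s : Set (Eucl m),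
      IsVanishingOn u s ∧ IsOpen s ∧ (x : Eucl m) ∈ s :=
    fun x => (notMem_dsupport_iff _).1 (h x.2)
  choose s hs hso hxs using hloc
  obtain ⟨F, hF⟩ := IsCompact.elim_finite_subcover hφ s hso
    (fun x hx => Set.mem_iUnion.2 ⟨⟨x, hx⟩, hxs ⟨x, hx⟩⟩)
  obtain ⟨ρ, hρ⟩ := SmoothPartitionOfUnity.exists_isSubordinate 𝓘(ℝ, Eucl m)
    (isClosed_tsupport φ) (fun i : F => s i) (fun i => hso i) (by
      intro x hx
      obtain ⟨i, hi, hxi⟩ := Set.mem_iUnion₂.1 (hF hx)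
      exact Set.mem_iUnion.2 ⟨⟨i, hi⟩, hxi⟩)
  have hsm : ∀ i, ContDiff ℝ ∞ (fun x => (ρ i x : ℂ) * φ x) := fun i =>
    (Complex.ofRealCLM.contDiff.comp (ρ i).contMDiff.contDiff).mul (φ.smooth ⊤)
  have hcs : ∀ i, HasCompactSupport (fun x => (ρ i x : ℂ) * φ x) := fun i => hφ.mul_left
  -- The finitely many pieces of `φ` live on open sets on which `u` vanishes.
  have hsum : φ = ∑ i, (hcs i).toSchwartzMap (hsm i) := by
    ext x
    rw [_root_.sum_apply]
    change φ x = ∑ i, (ρ i x : ℂ) * φ x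
    rw [← Finset.sum_mul]
    by_cases hx : x ∈ tsupport φ
    · have h1 := ρ.sum_eq_one hx
      rw [finsum_eq_sum_of_fintype] at h1
      rw [← Complex.ofReal_sum, h1, Complex.ofReal_one, one_mul]
    · rw [image_eq_zero_of_notMem_tsupport hx, mul_zero]
  rw [hsum, map_sum]
  refine Finset.sum_eq_zero fun i _ => hs i _ ?_
  refine Set.Subset.trans ?_ (hρ i)
  refine closure_mono fun x hx => ?_
  rw [Function.mem_support] at hx ⊢
  intro h0
  apply hx
  simp [h0]

/-- Membership of `Hˢ_F` can be tested on the test functions with compact support off `F`. -/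
theorem mem_supportedIn_iff {m : ℕ} {s : ℝ} {F : Set (Eucl m)} (hF : IsClosed F)
    (u : Sobolev m s) :
    u ∈ supportedIn m s F ↔ ∀ φ : 𝓢(Eucl m, ℂ), HasCompactSupport φ → tsupport φ ⊆ Fᶜ →
      Sobolev.toDistr m s u φ = 0 := by
  constructor
  · intro hu φ hφ hsupp
    exact eq_zero_of_tsupport_subset_compl_dsupport _ φ hφ
      (hsupp.trans (Set.compl_subset_compl.2 hu))
  · intro h x hx
    -- `IsVanishingOn` has no compactness condition on the test functions; in a ball it is
    -- automatic.
    by_contra hxF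
    obtain ⟨r, hr, hball⟩ := Metric.isOpen_iff.1 hF.isOpen_compl x hxF
    refine (notMem_dsupport_iff x).2 ⟨Metric.ball x r, fun φ hφ => ?_, Metric.isOpen_ball,
      Metric.mem_ball_self hr⟩ hx
    refine h φ ?_ (hφ.trans hball)
    exact (isCompact_closedBall x r).of_isClosed_subset (isClosed_tsupport _)
      (hφ.trans Metric.ball_subset_closedBall)

theorem isClosed_supportedIn {m : ℕ} (s : ℝ) {F : Set (Eucl m)} (hF : IsClosed F) :
    IsClosed (supportedIn m s F : Set (Sobolev m s)) := by
  have h1 : (supportedIn m s F : Set (Sobolev m s)) =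
      ⋂ φ : {φ : 𝓢(Eucl m, ℂ) // HasCompactSupport φ ∧ tsupport φ ⊆ Fᶜ},
        {u | Sobolev.evalCLM m s φ u = 0} := by
    ext u
    simp only [SetLike.mem_coe, mem_supportedIn_iff hF, Set.mem_iInter, Set.mem_ofPred_eq,
      Subtype.forall, and_imp, Sobolev.evalCLM_apply]
  rw [h1]
  exact isClosed_iInter fun φ => isClosed_eq (Sobolev.evalCLM m s φ).continuous continuous_const

/-- Weak limits of piecewise constant functions on meshes of sets that shrink to `Γ` are
supported in `Γ`. -/
theorem mem_supportedIn_of_weak_limit {m : ℕ} {s : ℝ} {Γ : Set (Eucl m)} (hΓ : IsCompact Γ)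
    {Ω : ℕ → Set (Eucl m)} {η : ℕ → ℝ} (hη : Tendsto η atTop (𝓝 0))
    (houter : ∀ j, Ω j ⊆ Metric.thickening (η j) Γ) (M : ∀ j, PreConvexMesh (Ω j))
    {w : ℕ → Sobolev m s} (hw : ∀ i, w i ∈ (M i).piecewiseConst s) {v : Sobolev m s}
    (hv : ∀ l : Sobolev m s →L[ℂ] ℂ, Tendsto (fun i => l (w i)) atTop (𝓝 (l v))) :
    v ∈ supportedIn m s Γ := by
  rw [mem_supportedIn_iff hΓ.isClosed]
  intro φ _ hsupp
  obtain ⟨δ, hδ, hsub⟩ := hΓ.exists_thickening_subset_open (isClosed_tsupport φ).isOpen_compl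
    (Set.subset_compl_comm.1 hsupp)
  refine tendsto_nhds_unique (hv (Sobolev.evalCLM m s φ)) ?_
  refine tendsto_const_nhds.congr' ?_
  filter_upwards [hη.eventually_lt_const hδ] with i hi
  obtain ⟨f, hf, hf0, -⟩ := hw i
  rw [Sobolev.evalCLM_apply, hf, Lp.toTemperedDistribution_apply, eq_comm]
  refine integral_eq_zero_of_ae ?_
  filter_upwards [hf0] with x hx
  by_cases hxΩ : x ∈ Ω i
  · have : x ∉ tsupport φ := hsub (Metric.thickening_mono hi.le Γ (houter i hxΩ))
    rw [image_eq_zero_of_notMem_tsupport this, zero_smul, Pi.zero_apply]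
  · rw [hx hxΩ, smul_zero, Pi.zero_apply]

end ScreenBEM

end

noncomputable section

namespace ScreenBEM

open scoped ContDiff Convolution Pointwise

/-! ### Mollification -/

/-- The Schwartz function `μ` is the symbol of a mollifier supported in the ball of radius
`1/2`. -/
structure IsMollifierSymbol {m : ℕ} (μ : 𝓢(Eucl m, ℂ)) : Prop where
  apply_zero : μ 0 = 1
  fourier_eq_zero : ∀ x : Eucl m, 1 / 2 < ‖x‖ → 𝓕 μ x = 0

theorem exists_isMollifierSymbol (m : ℕ) : ∃ μ : 𝓢(Eucl m, ℂ), IsMollifierSymbol μ := by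
  let b : ContDiffBump (0 : Eucl m) := ⟨1 / 4, 1 / 2, by norm_num, by norm_num⟩
  have hsm : ContDiff ℝ ∞ (fun x => (b.normed volume x : ℂ)) :=
    Complex.ofRealCLM.contDiff.comp b.contDiff_normed
  have hcs : HasCompactSupport (fun x => (b.normed volume x : ℂ)) :=
    (b.hasCompactSupport_normed (μ := volume)).comp_left (g := fun r : ℝ => (r : ℂ))
      Complex.ofReal_zero
  refine ⟨𝓕⁻ (hcs.toSchwartzMap hsm), ?_, fun x hx => ?_⟩
  · rw [SchwartzMap.fourierInv_coe, Real.fourierInv_eq]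
    simp only [inner_zero_right, AddChar.map_zero_eq_one, one_smul]
    change ∫ x, (b.normed volume x : ℂ) = 1
    rw [integral_complex_ofReal, b.integral_normed, Complex.ofReal_one]
  · rw [FourierTransform.fourier_fourierInv_eq]
    change (b.normed volume x : ℂ) = 0
    rw [Complex.ofReal_eq_zero, ← Function.notMem_support, b.support_normed_eq]
    rw [mem_ball_zero_iff]
    exact not_lt.2 hx.le

/-- The dilated function `ξ ↦ μ (ε ξ)`. -/
def dilate {m : ℕ} (μ : 𝓢(Eucl m, ℂ)) {ε : ℝ} (hε : 0 < ε) : 𝓢(Eucl m, ℂ) :=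
  SchwartzMap.compCLMOfContinuousLinearEquiv ℂ
    (ContinuousLinearEquiv.smulLeft (Units.mk0 ε hε.ne') : Eucl m ≃L[ℝ] Eucl m) μ

theorem dilate_apply {m : ℕ} (μ : 𝓢(Eucl m, ℂ)) {ε : ℝ} (hε : 0 < ε) (ξ : Eucl m) :
    dilate μ hε ξ = μ (ε • ξ) := rfl

theorem IsMollifierSymbol.fourier_dilate_eq_zero {m : ℕ} {μ : 𝓢(Eucl m, ℂ)}
    (hμ : IsMollifierSymbol μ) {ε : ℝ} (hε : 0 < ε) {x : Eucl m} (hx : ε / 2 < ‖x‖) :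
    𝓕 (dilate μ hε) x = 0 := by
  have h1 := hμ.fourier_eq_zero (ε⁻¹ • x) (by
    rw [norm_smul, norm_inv, Real.norm_of_nonneg hε.le, lt_inv_mul_iff₀ hε]
    linarith)
  rw [SchwartzMap.fourier_coe, Real.fourier_eq] at h1 ⊢
  have h2 := Measure.integral_comp_smul (volume : Measure (Eucl m))
    (fun v => Real.fourierChar (-inner ℝ v (ε⁻¹ • x)) • μ v) ε
  rw [h1, smul_zero] at h2
  rw [← h2]
  refine integral_congr_ae (Eventually.of_forall fun v => ?_)
  simp only [dilate_apply, inner_smul_left, inner_smul_right, RCLike.conj_to_real]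
  rw [inv_mul_cancel_left₀ hε.ne']

/-- The convolution theorem, in the form in which it meets the adjoint of the mollification
operator. -/
theorem fourier_smul_fourierInv_apply {m : ℕ} (κ φ : 𝓢(Eucl m, ℂ)) (x : Eucl m) :
    𝓕 (SchwartzMap.smulLeftCLM ℂ (𝓕⁻ κ : 𝓢(Eucl m, ℂ)) (𝓕⁻ φ)) x =
      ((κ : Eucl m → ℂ) ⋆[ContinuousLinearMap.mul ℂ ℂ] (φ : Eucl m → ℂ)) x := by
  rw [← SchwartzMap.convolution_apply, SchwartzMap.convolution]
  change _ = (𝓕⁻ (SchwartzMap.pairing (ContinuousLinearMap.mul ℂ ℂ) (𝓕 κ) (𝓕 φ)) :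
    𝓢(Eucl m, ℂ)) x
  set G : 𝓢(Eucl m, ℂ) := SchwartzMap.pairing (ContinuousLinearMap.mul ℂ ℂ) (𝓕 κ) (𝓕 φ) with hG
  rw [SchwartzMap.fourier_coe, SchwartzMap.fourierInv_coe G,
    Real.fourierInv_eq_fourier_comp_neg (G : Eucl m → ℂ)]
  refine congrArg (fun f : Eucl m → ℂ => 𝓕 f x) (funext fun ξ => ?_)
  rw [SchwartzMap.smulLeftCLM_apply_apply (SchwartzMap.hasTemperateGrowth _),
    hG, SchwartzMap.pairing_apply_apply, SchwartzMap.fourierInv_coe, SchwartzMap.fourierInv_coe,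
    Real.fourierInv_eq_fourier_neg, Real.fourierInv_eq_fourier_neg]
  rfl

theorem hasTemperateGrowth_toBoundedContinuousFunction {m : ℕ} (f : 𝓢(Eucl m, ℂ)) :
    (f.toBoundedContinuousFunction : Eucl m → ℂ).HasTemperateGrowth :=
  f.hasTemperateGrowth

/-- Mollifying a test function at scale `ε` enlarges its support by at most `ε / 2`. -/
theorem IsMollifierSymbol.tsupport_subset {m : ℕ} {μ : 𝓢(Eucl m, ℂ)}
    (hμ : IsMollifierSymbol μ) {ε : ℝ} (hε : 0 < ε) (φ : 𝓢(Eucl m, ℂ))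
    (hφ : HasCompactSupport φ) :
    tsupport (𝓕 (SchwartzMap.smulLeftCLM ℂ (dilate μ hε) (𝓕⁻ φ)) : 𝓢(Eucl m, ℂ)) ⊆
      Metric.closedBall 0 (ε / 2) + tsupport φ := by
  refine closure_minimal ?_
    ((isCompact_closedBall (0 : Eucl m) (ε / 2)).add hφ).isClosed
  have h1 : dilate μ hε = (𝓕⁻ (𝓕 (dilate μ hε) : 𝓢(Eucl m, ℂ)) : 𝓢(Eucl m, ℂ)) :=
    (FourierTransform.fourierInv_fourier_eq _).symm
  rw [h1]
  intro x hx
  rw [Function.mem_support, fourier_smul_fourierInv_apply] at hx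
  refine Set.add_subset_add ?_ (subset_tsupport φ) (support_convolution_subset _ hx)
  intro y hy
  rw [mem_closedBall_zero_iff]
  by_contra h
  exact hy (hμ.fourier_dilate_eq_zero hε (not_le.1 h))

/-- The mollification at scale `ε` of an element of `Hᵗ(ℝᵐ)`, an `L²` function: its Fourier
transform is `μ (ε ξ)` times that of the distribution. The weight of order `-t` cancels the one in
`Sobolev.symbol`. -/
def mollify {m : ℕ} {t : ℝ} (μ : 𝓢(Eucl m, ℂ)) {ε : ℝ} (hε : 0 < ε) (v : Sobolev m t) :
    Lp ℂ 2 (volume : Measure (Eucl m)) :=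
  𝓕⁻ (l2Mul (SchwartzMap.smulLeftCLM ℂ (sobolevWeight m (-t))
    (dilate μ hε)).toBoundedContinuousFunction (Sobolev.symbol m t v))

theorem toTemperedDistribution_mollify {m : ℕ} {t : ℝ} (μ : 𝓢(Eucl m, ℂ)) {ε : ℝ} (hε : 0 < ε)
    (v : Sobolev m t) :
    Lp.toTemperedDistribution (mollify μ hε v) =
      𝓕⁻ (TemperedDistribution.smulLeftCLM ℂ (dilate μ hε) (𝓕 (Sobolev.toDistr m t v))) := by
  rw [mollify, ← Lp.fourierInv_toTemperedDistribution_eq, toTemperedDistribution_l2Mul _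
    (hasTemperateGrowth_toBoundedContinuousFunction _), ← Sobolev.weightedFourier_toDistr,
    weightedFourier,
    TemperedDistribution.smulLeftCLM_smulLeftCLM_apply (sobolevWeight_hasTemperateGrowth m t)
    (hasTemperateGrowth_toBoundedContinuousFunction _)]
  congr 3
  funext ξ
  rw [Pi.mul_apply, SchwartzMap.toBoundedContinuousFunction_apply,
    SchwartzMap.smulLeftCLM_apply_apply (sobolevWeight_hasTemperateGrowth m (-t)), smul_eq_mul,
    ← mul_assoc]
  have h1 := congrFun (sobolevWeight_mul_neg m t) ξ
  rw [Pi.mul_apply] at h1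
  rw [h1, one_mul]

/-- The mollification at scale `ε` of a distribution supported in `Γ` vanishes outside the
`ε`-neighbourhood of `Γ`. -/
theorem IsMollifierSymbol.mollify_ae_eq_zero {m : ℕ} {t : ℝ} {μ : 𝓢(Eucl m, ℂ)}
    (hμ : IsMollifierSymbol μ) {ε : ℝ} (hε : 0 < ε) {Γ : Set (Eucl m)} (hΓ : IsClosed Γ)
    {v : Sobolev m t} (hv : v ∈ supportedIn m t Γ) :
    ∀ᵐ x, x ∉ Metric.thickening ε Γ → mollify μ hε v x = 0 := by
  have h1 : ∀ᵐ x, x ∈ (Metric.cthickening (ε / 2) Γ)ᶜ → mollify μ hε v x = 0 := by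
    refine Metric.isClosed_cthickening.isOpen_compl.ae_eq_zero_of_integral_contDiff_smul_eq_zero
      (((Lp.memLp _).locallyIntegrable one_le_two).locallyIntegrableOn _) ?_
    intro g hg hgc hgs
    have hsm : ContDiff ℝ ∞ (fun x => (g x : ℂ)) := Complex.ofRealCLM.contDiff.comp hg
    have hcs : HasCompactSupport (fun x => (g x : ℂ)) :=
      hgc.comp_left (g := fun r : ℝ => (r : ℂ)) Complex.ofReal_zero
    have hts : tsupport (fun x => (g x : ℂ)) ⊆ tsupport g :=
      closure_mono fun x hx h => hx (by simp [h])
    set φ : 𝓢(Eucl m, ℂ) := hcs.toSchwartzMap hsm with hφ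
    have h2 : ∫ x, g x • mollify μ hε v x = Lp.toTemperedDistribution (mollify μ hε v) φ := by
      rw [Lp.toTemperedDistribution_apply]
      rfl
    rw [h2, toTemperedDistribution_mollify, TemperedDistribution.fourierInv_apply,
      TemperedDistribution.smulLeftCLM_apply_apply, TemperedDistribution.fourier_apply]
    have hcpt : IsCompact (Metric.closedBall (0 : Eucl m) (ε / 2) + tsupport φ) :=
      (isCompact_closedBall _ _).add hcs
    have hsub := hμ.tsupport_subset hε φ hcs
    refine (mem_supportedIn_iff hΓ v).1 hv _
      (hcpt.of_isClosed_subset (isClosed_tsupport _) hsub) (hsub.trans ?_)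
    rintro _ ⟨y, hy, z, hz, rfl⟩ hΓ'
    refine hgs (hts hz) ?_
    refine Metric.mem_cthickening_of_dist_le z (y + z) _ _ hΓ' ?_
    rw [dist_comm, dist_eq_norm, add_sub_cancel_right]
    exact mem_closedBall_zero_iff.1 hy
  filter_upwards [h1] with x hx hxε
  exact hx fun h => hxε (Metric.cthickening_subset_thickening' hε (by linarith) Γ h)

/-- The symbol `(1 + |2πξ|²)^(-t/2) μ (ε ξ)` is of order `εᵗ`, because
`1 + |2πξ|² ≤ ε⁻² (1 + |2πεξ|²)` for `ε ≤ 1` and `μ` decays rapidly. -/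
theorem norm_dilate_weight_le {m : ℕ} {t : ℝ} (ht : t ∈ Set.Icc (-1 / 2 : ℝ) 0)
    (μ : 𝓢(Eucl m, ℂ)) :
    ∃ C, ∀ ε, ∀ hε : 0 < ε, ε ≤ 1 → ∀ ξ,
      ‖SchwartzMap.smulLeftCLM ℂ (sobolevWeight m (-t)) (dilate μ hε) ξ‖ ≤ C * ε ^ t := by
  refine ⟨SchwartzMap.seminorm ℝ 0 0 (SchwartzMap.smulLeftCLM ℂ (sobolevWeight m (-t)) μ),
    fun ε hε hε1 ξ => ?_⟩
  have h1 := SchwartzMap.norm_le_seminorm ℝ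
    (SchwartzMap.smulLeftCLM ℂ (sobolevWeight m (-t)) μ) (ε • ξ)
  have hw := sobolevWeight_hasTemperateGrowth m (-t)
  rw [SchwartzMap.smulLeftCLM_apply_apply hw, norm_smul, norm_sobolevWeight] at h1 ⊢
  rw [dilate_apply]
  have hb : 0 ≤ -t / 2 := by linarith [ht.2]
  have h2 : (1 + ‖(2 * Real.pi) • ξ‖ ^ 2) ^ (-t / 2) ≤
      (1 + ‖(2 * Real.pi) • ε • ξ‖ ^ 2) ^ (-t / 2) * ε ^ t := by
    have h3 : ε ^ t = ((ε ^ 2)⁻¹) ^ (-t / 2) := by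
      rw [Real.inv_rpow (by positivity), ← Real.rpow_natCast, ← Real.rpow_mul hε.le,
        ← Real.rpow_neg hε.le]
      congr 1
      push_cast
      ring
    rw [h3, ← Real.mul_rpow (by positivity) (by positivity)]
    refine Real.rpow_le_rpow (by positivity) ?_ hb
    rw [smul_comm, norm_smul ε, Real.norm_of_nonneg hε.le, ← div_eq_mul_inv,
      le_div_iff₀ (by positivity)]
    have : ε ^ 2 ≤ 1 := pow_le_one₀ hε.le hε1
    nlinarith
  calc _ ≤ (1 + ‖(2 * Real.pi) • ε • ξ‖ ^ 2) ^ (-t / 2) * ε ^ t * ‖μ (ε • ξ)‖ :=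
        mul_le_mul_of_nonneg_right h2 (norm_nonneg _)
    _ = (1 + ‖(2 * Real.pi) • ε • ξ‖ ^ 2) ^ (-t / 2) * ‖μ (ε • ξ)‖ * ε ^ t := by ring
    _ ≤ _ := mul_le_mul_of_nonneg_right h1 (by positivity)

/-- The mollification at scale `ε` maps `Hᵗ` to `L²` with norm of order `εᵗ`. -/
theorem exists_norm_mollify_le {m : ℕ} {t : ℝ} (ht : t ∈ Set.Icc (-1 / 2 : ℝ) 0)
    (μ : 𝓢(Eucl m, ℂ)) (v : Sobolev m t) :
    ∃ C, ∀ ε, ∀ hε : 0 < ε, ε ≤ 1 → ‖mollify μ hε v‖ ≤ C * ε ^ t := by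
  obtain ⟨C, hC⟩ := norm_dilate_weight_le ht μ
  refine ⟨C * ‖v‖, fun ε hε hε1 => ?_⟩
  have h1 : ‖mollify μ hε v‖ = ‖𝓕 (mollify μ hε v)‖ := (Lp.norm_fourier_eq _).symm
  rw [h1, mollify, FourierTransform.fourier_fourierInv_eq]
  refine (norm_l2Mul_le _ (hC ε hε hε1) _).trans (le_of_eq ?_)
  rw [Sobolev.norm_eq]
  ring

/-- The mollification depends on the distribution only, not on the space `Hᵗ` in which it is
taken: on the symbol of order `s` it is multiplication by `μ (ε ξ)`. -/
theorem symbol_ofL2_mollify {m : ℕ} {s t : ℝ} (hs : s ≤ 0) (μ : 𝓢(Eucl m, ℂ)) {ε : ℝ}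
    (hε : 0 < ε) {v : Sobolev m s} {w : Sobolev m t}
    (h : Sobolev.toDistr m t w = Sobolev.toDistr m s v) :
    Sobolev.symbol m s (Sobolev.ofL2 m hs (mollify μ hε w)) =
      l2Mul (dilate μ hε).toBoundedContinuousFunction (Sobolev.symbol m s v) := by
  apply toTemperedDistribution_injective m
  rw [← Sobolev.weightedFourier_toDistr, Sobolev.toDistr_ofL2, toTemperedDistribution_mollify,
    weightedFourier, FourierTransform.fourier_fourierInv_eq, h,
    toTemperedDistribution_l2Mul _ (hasTemperateGrowth_toBoundedContinuousFunction _),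
    ← Sobolev.weightedFourier_toDistr, weightedFourier,
    TemperedDistribution.smulLeftCLM_smulLeftCLM_apply (sobolevWeight_hasTemperateGrowth m s)
      (hasTemperateGrowth_toBoundedContinuousFunction _),
    TemperedDistribution.smulLeftCLM_smulLeftCLM_apply (SchwartzMap.hasTemperateGrowth _)
      (sobolevWeight_hasTemperateGrowth m s), mul_comm]
  rfl

theorem norm_sq_eq_integral {m : ℕ} (f : Lp ℂ 2 (volume : Measure (Eucl m))) :
    ‖f‖ ^ 2 = ∫ x, ‖f x‖ ^ 2 := by
  have h1 : ((‖f‖ ^ 2 : ℝ) : ℂ) = ((∫ x, ‖f x‖ ^ 2 : ℝ) : ℂ) := by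
    rw [← integral_complex_ofReal, Complex.ofReal_pow]
    refine (inner_self_eq_norm_sq_to_K (𝕜 := ℂ) f).symm.trans ?_
    rw [L2.inner_def]
    refine integral_congr_ae (Eventually.of_forall fun x => ?_)
    simp only [Complex.ofReal_pow]
    exact inner_self_eq_norm_sq_to_K (𝕜 := ℂ) (f x)
  exact_mod_cast h1

/-- Convergence of the mollifications, on the Fourier side: `μ (ε ξ) → μ 0 = 1` boundedly. -/
theorem IsMollifierSymbol.tendsto_l2Mul {m : ℕ} {μ : 𝓢(Eucl m, ℂ)} (hμ : IsMollifierSymbol μ)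
    {ε : ℕ → ℝ} (hε : ∀ j, 0 < ε j) (h0 : Tendsto ε atTop (𝓝 0))
    (g : Lp ℂ 2 (volume : Measure (Eucl m))) :
    Tendsto (fun j => l2Mul (dilate μ (hε j)).toBoundedContinuousFunction g) atTop (𝓝 g) := by
  rw [tendsto_iff_norm_sub_tendsto_zero]
  have hsq : Tendsto (fun j => ‖l2Mul (dilate μ (hε j)).toBoundedContinuousFunction g - g‖ ^ 2)
      atTop (𝓝 0) := by
    have h1 : ∀ j, ‖l2Mul (dilate μ (hε j)).toBoundedContinuousFunction g - g‖ ^ 2 =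
        ∫ x, ‖μ (ε j • x) - 1‖ ^ 2 * ‖g x‖ ^ 2 := by
      intro j
      rw [norm_sq_eq_integral]
      refine integral_congr_ae ?_
      filter_upwards [Lp.coeFn_sub (l2Mul (dilate μ (hε j)).toBoundedContinuousFunction g) g,
        coeFn_l2Mul (dilate μ (hε j)).toBoundedContinuousFunction g] with x h2 h3
      rw [h2, Pi.sub_apply, h3, SchwartzMap.toBoundedContinuousFunction_apply, dilate_apply,
        ← mul_pow, ← norm_mul, sub_mul, one_mul]
    simp_rw [h1]
    set K := SchwartzMap.seminorm ℝ 0 0 μ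
    have h4 : (0 : ℝ) = ∫ x : Eucl m, (0 : ℝ) := by simp
    rw [h4]
    refine tendsto_integral_of_dominated_convergence (fun x => (K + 1) ^ 2 * ‖g x‖ ^ 2) ?_ ?_ ?_ ?_
    · intro j
      refine AEStronglyMeasurable.mul ?_ ((Lp.aestronglyMeasurable g).norm.pow 2)
      refine Continuous.aestronglyMeasurable ?_
      have := μ.continuous
      fun_prop
    · exact ((memLp_two_iff_integrable_sq_norm (Lp.aestronglyMeasurable g)).1
        (Lp.memLp g)).const_mul _
    · intro j
      refine Eventually.of_forall fun x => ?_
      rw [Real.norm_of_nonneg (by positivity)]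
      refine mul_le_mul_of_nonneg_right (pow_le_pow_left₀ (norm_nonneg _) ?_ 2) (by positivity)
      refine (norm_sub_le _ _).trans ?_
      rw [norm_one]
      exact add_le_add_left (SchwartzMap.norm_le_seminorm ℝ μ _) 1
    · refine Eventually.of_forall fun x => ?_
      have h5 : Tendsto (fun j => μ (ε j • x)) atTop (𝓝 1) := by
        rw [← hμ.apply_zero]
        refine (μ.continuous.tendsto 0).comp ?_
        simpa using h0.smul_const x
      have h6 := ((h5.sub_const 1).norm.pow 2).mul_const (‖g x‖ ^ 2)
      simpa using h6
  have h7 := hsq.sqrt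
  simpa [Real.sqrt_sq] using h7

end ScreenBEM

end

noncomputable section

namespace ScreenBEM

open scoped ENNReal

/-! ### A Poincaré inequality on convex sets -/

theorem sq_lintegral_le_lintegral_sq {α : Type*} [MeasurableSpace α] (ν : Measure α)
    [IsProbabilityMeasure ν] {f : α → ℝ≥0∞} (hf : AEMeasurable f ν) :
    (∫⁻ a, f a ∂ν) ^ 2 ≤ ∫⁻ a, f a ^ 2 ∂ν := by
  have h := eLpNorm_le_eLpNorm_of_exponent_le (μ := ν) (p := 1) (q := 2) one_le_two
    hf.aestronglyMeasurable
  rw [eLpNorm_one_eq_lintegral_enorm] at h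
  have h2 := eLpNorm_nnreal_pow_eq_lintegral (f := f) (μ := ν) (p := 2) two_ne_zero
  simp only [NNReal.coe_ofNat, ENNReal.coe_ofNat, ENNReal.rpow_ofNat, enorm_eq_self] at h h2
  rw [← h2]
  gcongr

/-- The fundamental theorem of calculus along a segment, combined with Jensen's inequality. -/
theorem enorm_sub_sq_le_lintegral_fderiv {m : ℕ} {φ : Eucl m → ℂ} (hφ : ContDiff ℝ 1 φ)
    (x v : Eucl m) :
    ‖φ (x + v) - φ x‖ₑ ^ 2 ≤
      ‖v‖ₑ ^ 2 * ∫⁻ s in Set.Ioc (0 : ℝ) 1, ‖fderiv ℝ φ (x + s • v)‖ₑ ^ 2 := by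
  have hcont : Continuous fun s : ℝ => fderiv ℝ φ (x + s • v) :=
    (hφ.continuous_fderiv one_ne_zero).comp (by fun_prop)
  have hd : ∀ s : ℝ, HasDerivAt (fun s : ℝ => φ (x + s • v)) (fderiv ℝ φ (x + s • v) v) s := by
    intro s
    have h1 : HasDerivAt (fun s : ℝ => x + s • v) v s := by
      simpa using ((hasDerivAt_id s).smul_const v).const_add x
    exact ((hφ.differentiable one_ne_zero).differentiableAt.hasFDerivAt).comp_hasDerivAt s h1
  have hftc := intervalIntegral.integral_eq_sub_of_hasDerivAt (a := 0) (b := 1)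
    (fun s _ => hd s) ((hcont.clm_apply continuous_const).intervalIntegrable _ _)
  rw [one_smul, zero_smul, add_zero] at hftc
  rw [← hftc, intervalIntegral.integral_of_le zero_le_one]
  have : IsProbabilityMeasure (volume.restrict (Set.Ioc (0 : ℝ) 1)) := ⟨by simp⟩
  have hm : Measurable fun s : ℝ => ‖fderiv ℝ φ (x + s • v)‖ₑ := hcont.enorm.measurable
  calc ‖∫ s in Set.Ioc (0 : ℝ) 1, fderiv ℝ φ (x + s • v) v‖ₑ ^ 2
      ≤ (∫⁻ s in Set.Ioc (0 : ℝ) 1, ‖v‖ₑ * ‖fderiv ℝ φ (x + s • v)‖ₑ) ^ 2 := by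
        refine pow_le_pow_left₀ zero_le (enorm_integral_le_lintegral_enorm _ |>.trans ?_) 2
        refine lintegral_mono fun s => ?_
        rw [mul_comm]
        exact ContinuousLinearMap.le_opENorm _ _
    _ = ‖v‖ₑ ^ 2 * (∫⁻ s in Set.Ioc (0 : ℝ) 1, ‖fderiv ℝ φ (x + s • v)‖ₑ) ^ 2 := by
        rw [lintegral_const_mul _ hm, mul_pow]
    _ ≤ _ := by
        gcongr
        exact sq_lintegral_le_lintegral_sq _ hm.aemeasurable

/-- Contracting a convex set by a factor at least `1/2` towards one of its points changes
integrals by a factor at most `2ᵐ`. -/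
theorem setLIntegral_homothety_le {m : ℕ} {K : Set (Eucl m)} (hK : Convex ℝ K)
    (hKm : MeasurableSet K) {G : Eucl m → ℝ≥0∞} (hG : Measurable G) {y : Eucl m} (hy : y ∈ K)
    {r : ℝ} (hr0 : 0 ≤ r) (hr : r ≤ 1 / 2) :
    ∫⁻ x in K, G (x + r • (y - x)) ≤ 2 ^ m * ∫⁻ x in K, G x := by
  have h1r : 0 < 1 - r := by linarith
  have hH : Measurable (K.indicator G) := hG.indicator hKm
  calc ∫⁻ x in K, G (x + r • (y - x))
      ≤ ∫⁻ x, K.indicator G ((1 - r) • x + r • y) := by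
        rw [← lintegral_indicator hKm]
        refine lintegral_mono fun x => ?_
        by_cases hx : x ∈ K
        · have h2 : x + r • (y - x) = (1 - r) • x + r • y := by
            rw [smul_sub, sub_smul, one_smul]
            abel
          have h3 : (1 - r) • x + r • y ∈ K := hK hx hy h1r.le hr0 (by ring)
          rw [Set.indicator_of_mem hx, Set.indicator_of_mem h3, h2]
        · rw [Set.indicator_of_notMem hx]
          exact zero_le
    _ = ∫⁻ z, K.indicator G (z + r • y) ∂(Measure.map ((1 - r) • ·) volume) := by
        exact (lintegral_map (μ := volume) (hH.comp (measurable_add_const (r • y)))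
          (measurable_const_smul (1 - r))).symm
    _ = ENNReal.ofReal |((1 - r) ^ m)⁻¹| * ∫⁻ x in K, G x := by
        rw [Measure.map_addHaar_smul volume h1r.ne', lintegral_smul_measure,
          lintegral_add_right_eq_self (fun z => K.indicator G z), lintegral_indicator hKm,
          finrank_euclideanSpace_fin, smul_eq_mul]
    _ ≤ _ := by
        gcongr
        rw [abs_of_pos (by positivity), ← inv_pow]
        refine ENNReal.ofReal_le_of_le_toReal ?_
        rw [ENNReal.toReal_pow, ENNReal.toReal_ofNat]
        refine pow_le_pow_left₀ (by positivity) ?_ m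
        rw [inv_le_comm₀ h1r two_pos]
        linarith

/-- Comparison of `φ x` with the value at the midpoint of `x` and `y`. All the points on the way
from `x` to the midpoint are images of `x` under homotheties with centre `y` and factor at least
`1/2`; on the whole segment from `x` to `y` the factor would degenerate to `0`. -/
theorem lintegral_enorm_sub_midpoint_sq_le {m : ℕ} {K : Set (Eucl m)} (hK : Convex ℝ K)
    (hKm : MeasurableSet K) {φ : Eucl m → ℂ} (hφ : ContDiff ℝ 1 φ) {y : Eucl m} (hy : y ∈ K)
    {d : ℝ≥0∞} (hd : ∀ x ∈ K, ∀ y ∈ K, edist x y ≤ d) :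
    ∫⁻ x in K, ‖φ (midpoint ℝ x y) - φ x‖ₑ ^ 2 ≤
      (d / 2) ^ 2 * (2 ^ m * ∫⁻ x in K, ‖fderiv ℝ φ x‖ₑ ^ 2) := by
  have hG : Continuous fun x => ‖fderiv ℝ φ x‖ₑ ^ 2 :=
    (ENNReal.continuous_pow 2).comp (hφ.continuous_fderiv one_ne_zero).enorm
  have hmid : ∀ x, midpoint ℝ x y = x + (2⁻¹ : ℝ) • (y - x) := fun x => by
    rw [midpoint_eq_smul_add, invOf_eq_inv, smul_add, smul_sub]
    module
  have hG2 : Measurable (Function.uncurry fun (x : Eucl m) (s : ℝ) =>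
      ‖fderiv ℝ φ (x + s • (2⁻¹ : ℝ) • (y - x))‖ₑ ^ 2) :=
    (hG.comp (by fun_prop : Continuous fun p : Eucl m × ℝ =>
      p.1 + p.2 • (2⁻¹ : ℝ) • (y - p.1))).measurable
  calc ∫⁻ x in K, ‖φ (midpoint ℝ x y) - φ x‖ₑ ^ 2
      ≤ ∫⁻ x in K, (d / 2) ^ 2 * ∫⁻ s in Set.Ioc (0 : ℝ) 1,
          ‖fderiv ℝ φ (x + s • (2⁻¹ : ℝ) • (y - x))‖ₑ ^ 2 := by
        refine setLIntegral_mono' hKm fun x hx => ?_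
        rw [hmid]
        refine (enorm_sub_sq_le_lintegral_fderiv hφ x _).trans ?_
        gcongr
        have h1 : ‖(2⁻¹ : ℝ)‖ₑ = 2⁻¹ := by
          rw [enorm_inv two_ne_zero, Real.enorm_eq_ofReal zero_le_two, ENNReal.ofReal_ofNat]
        rw [enorm_smul, h1, ← edist_eq_enorm_sub, mul_comm, ← div_eq_mul_inv]
        gcongr
        exact hd y hy x hx
    _ = (d / 2) ^ 2 * ∫⁻ s in Set.Ioc (0 : ℝ) 1, ∫⁻ x in K,
          ‖fderiv ℝ φ (x + s • (2⁻¹ : ℝ) • (y - x))‖ₑ ^ 2 := by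
        have h1 : Measurable fun x => ∫⁻ s in Set.Ioc (0 : ℝ) 1,
            ‖fderiv ℝ φ (x + s • (2⁻¹ : ℝ) • (y - x))‖ₑ ^ 2 := hG2.lintegral_prod_right'
        rw [lintegral_const_mul _ h1, lintegral_lintegral_swap hG2.aemeasurable]
    _ ≤ (d / 2) ^ 2 * ∫⁻ s in Set.Ioc (0 : ℝ) 1, (2 ^ m * ∫⁻ x in K, ‖fderiv ℝ φ x‖ₑ ^ 2) := by
        refine mul_le_mul' le_rfl (setLIntegral_mono' measurableSet_Ioc fun s hs => ?_)
        simp_rw [smul_smul]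
        exact setLIntegral_homothety_le hK hKm hG.measurable hy (by linarith [hs.1])
          (by linarith [hs.2])
    _ = _ := by simp

theorem lintegral_lintegral_add_swap {α : Type*} [MeasurableSpace α] (ν : Measure α) [SFinite ν]
    {f : α → α → ℝ≥0∞} (hf : Measurable (Function.uncurry f)) :
    ∫⁻ a, ∫⁻ b, (f a b + f b a) ∂ν ∂ν = 2 * ∫⁻ a, ∫⁻ b, f a b ∂ν ∂ν := by
  have h1 : ∀ a, Measurable (f a) := fun a => hf.of_uncurry_left
  have h2 : Measurable fun a => ∫⁻ b, f a b ∂ν := hf.lintegral_prod_right'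
  simp_rw [fun a => lintegral_add_left (μ := ν) (h1 a)]
  rw [lintegral_add_left h2, lintegral_lintegral_swap (f := fun a b => f b a)
    (hf.comp measurable_swap).aemeasurable, two_mul]

/-- A Poincaré inequality on a convex set, whose constant depends on the dimension and the
diameter only. -/
theorem exists_setLIntegral_enorm_sub_sq_le {m : ℕ} {K : Set (Eucl m)} (hK : Convex ℝ K)
    (hKo : IsOpen K) (hne : K.Nonempty) (hKb : Bornology.IsBounded K) {φ : Eucl m → ℂ}
    (hφ : ContDiff ℝ 1 φ) {d : ℝ≥0∞} (hd : ∀ x ∈ K, ∀ y ∈ K, edist x y ≤ d) :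
    ∃ y, ∫⁻ x in K, ‖φ x - φ y‖ₑ ^ 2 ≤
      d ^ 2 * (2 ^ m * ∫⁻ x in K, ‖fderiv ℝ φ x‖ₑ ^ 2) := by
  have hKm := hKo.measurableSet
  have hc := hφ.continuous
  set I := 2 ^ m * ∫⁻ x in K, ‖fderiv ℝ φ x‖ₑ ^ 2 with hI
  have hvol0 : volume K ≠ 0 := (hKo.measure_pos volume hne).ne'
  have hvol : volume K ≠ ∞ := hKb.measure_lt_top.ne
  have hm1 : Continuous (Function.uncurry fun y x : Eucl m =>
      ‖φ (midpoint ℝ x y) - φ x‖ₑ ^ 2) := by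
    refine (ENNReal.continuous_pow 2).comp (Continuous.enorm ?_)
    have hmid : Continuous fun p : Eucl m × Eucl m => midpoint ℝ p.2 p.1 := by
      simp only [midpoint_eq_smul_add]
      fun_prop
    exact (hc.comp hmid).sub (hc.comp continuous_snd)
  have hm2 : Continuous fun p : Eucl m × Eucl m => ‖φ p.2 - φ p.1‖ₑ ^ 2 := by
    refine (ENNReal.continuous_pow 2).comp (Continuous.enorm ?_)
    exact (hc.comp continuous_snd).sub (hc.comp continuous_fst)
  have hA : ∫⁻ y in K, ∫⁻ x in K, ‖φ (midpoint ℝ x y) - φ x‖ₑ ^ 2 ≤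
      (d / 2) ^ 2 * I * volume K := by
    calc _ ≤ ∫⁻ y in K, (d / 2) ^ 2 * I := setLIntegral_mono' hKm fun y hy =>
          lintegral_enorm_sub_midpoint_sq_le hK hKm hφ hy hd
      _ = _ := by rw [setLIntegral_const]
  -- Compare `φ x` and `φ y` through the midpoint of `x` and `y`.
  have hsum : ∫⁻ y in K, ∫⁻ x in K, ‖φ x - φ y‖ₑ ^ 2 ≤ d ^ 2 * I * volume K := by
    calc ∫⁻ y in K, ∫⁻ x in K, ‖φ x - φ y‖ₑ ^ 2
        ≤ ∫⁻ y in K, ∫⁻ x in K, 2 * (‖φ (midpoint ℝ x y) - φ x‖ₑ ^ 2 +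
            ‖φ (midpoint ℝ y x) - φ y‖ₑ ^ 2) := by
          refine lintegral_mono fun y => lintegral_mono fun x => ?_
          rw [midpoint_comm y x]
          have h1 : ‖φ x - φ y‖ₑ ≤
              ‖φ (midpoint ℝ x y) - φ x‖ₑ + ‖φ (midpoint ℝ x y) - φ y‖ₑ := by
            rw [← edist_eq_enorm_sub, ← edist_eq_enorm_sub, ← edist_eq_enorm_sub,
              edist_comm (φ (midpoint ℝ x y)) (φ x)]
            exact edist_triangle _ _ _
          refine (pow_le_pow_left₀ zero_le h1 2).trans ?_
          have h2 := ENNReal.rpow_add_le_mul_rpow_add_rpow ‖φ (midpoint ℝ x y) - φ x‖ₑ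
            ‖φ (midpoint ℝ x y) - φ y‖ₑ (p := 2) one_le_two
          simpa only [ENNReal.rpow_ofNat, show (2 : ℝ) - 1 = 1 by norm_num, ENNReal.rpow_one]
            using h2
      _ = 4 * ∫⁻ y in K, ∫⁻ x in K, ‖φ (midpoint ℝ x y) - φ x‖ₑ ^ 2 := by
          simp_rw [lintegral_const_mul' _ _ (ENNReal.ofNat_ne_top (n := 2))]
          rw [lintegral_lintegral_add_swap _
            (f := fun y x => ‖φ (midpoint ℝ x y) - φ x‖ₑ ^ 2) hm1.measurable, ← mul_assoc]
          norm_num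
      _ ≤ 4 * ((d / 2) ^ 2 * I * volume K) := by gcongr
      _ = d ^ 2 * I * volume K := by
          have h2 : d ^ 2 = 4 * (d / 2) ^ 2 := by
            have : d = 2 * (d / 2) := (ENNReal.mul_div_cancel two_ne_zero ENNReal.ofNat_ne_top).symm
            calc d ^ 2 = (2 * (d / 2)) ^ 2 := by rw [← this]
              _ = _ := by ring
          rw [h2]
          ring
  -- Some `y` does at least as well as the average over `y`.
  obtain ⟨y, -, hy⟩ := exists_le_setLAverage hvol0 hvol
    (f := fun y => ∫⁻ x in K, ‖φ x - φ y‖ₑ ^ 2)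
    (hm2.measurable.lintegral_prod_right'.aemeasurable)
  refine ⟨y, hy.trans ?_⟩
  rw [setLAverage_eq]
  refine ENNReal.div_le_of_le_mul ?_
  exact hsum

end ScreenBEM

end

noncomputable section

namespace ScreenBEM

open scoped ENNReal LineDeriv

/-! ### The `L²` norm of the gradient -/

theorem norm_clm_sq_le_sum {m : ℕ} (L : Eucl m →L[ℝ] ℂ) :
    ‖L‖ ^ 2 ≤ ∑ i, ‖L (EuclideanSpace.single i 1)‖ ^ 2 := by
  have h1 : ‖L‖ ≤ √(∑ i, ‖L (EuclideanSpace.single i 1)‖ ^ 2) := by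
    refine L.opNorm_le_bound (Real.sqrt_nonneg _) fun v => ?_
    have hv : v = ∑ i, v i • EuclideanSpace.single i (1 : ℝ) := by
      have h := (EuclideanSpace.basisFun (Fin m) ℝ).sum_repr v
      simpa using h.symm
    conv_lhs => rw [hv, map_sum]
    calc ‖∑ i, L (v i • EuclideanSpace.single i (1 : ℝ))‖
        ≤ ∑ i, ‖L (EuclideanSpace.single i (1 : ℝ))‖ * ‖v i‖ := by
          refine (norm_sum_le _ _).trans (Finset.sum_le_sum fun i _ => ?_)
          rw [map_smul, norm_smul, mul_comm]
      _ ≤ √(∑ i, ‖L (EuclideanSpace.single i (1 : ℝ))‖ ^ 2) * √(∑ i, ‖v i‖ ^ 2) :=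
          Real.sum_mul_le_sqrt_mul_sqrt _ _ _
      _ = _ := by rw [EuclideanSpace.norm_eq v]
  calc ‖L‖ ^ 2 ≤ √(∑ i, ‖L (EuclideanSpace.single i 1)‖ ^ 2) ^ 2 := by gcongr
    _ = _ := Real.sq_sqrt (Finset.sum_nonneg fun i _ => by positivity)

theorem enorm_toLp_sq {m : ℕ} (χ : 𝓢(Eucl m, ℂ)) :
    ‖χ.toLp 2‖ₑ ^ 2 = ENNReal.ofReal (∫ x, ‖χ x‖ ^ 2) := by
  rw [← ofReal_norm, ← ENNReal.ofReal_pow (norm_nonneg _), norm_sq_eq_integral]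
  congr 1
  refine integral_congr_ae ?_
  filter_upwards [χ.coeFn_toLp 2] with x hx
  rw [hx]

theorem integrable_norm_sq {m : ℕ} (χ : 𝓢(Eucl m, ℂ)) : Integrable fun x => ‖χ x‖ ^ 2 :=
  (memLp_two_iff_integrable_sq_norm χ.continuous.aestronglyMeasurable).1 (χ.memLp 2)

/-- The operator with symbol `(1 + |2πξ|²)^(-1/2)` maps `L²` to `H¹`: the gradient of the image
of `χ` (given on the Fourier side) is bounded by `χ` in `L²`. -/
theorem lintegral_fderiv_sq_le {m : ℕ} (χ : 𝓢(Eucl m, ℂ)) :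
    ∫⁻ x, ‖fderiv ℝ (𝓕⁻ (SchwartzMap.smulLeftCLM ℂ (sobolevWeight m (-1)) χ) :
      𝓢(Eucl m, ℂ)) x‖ₑ ^ 2 ≤ ‖χ.toLp 2‖ₑ ^ 2 := by
  set φ : 𝓢(Eucl m, ℂ) := 𝓕⁻ (SchwartzMap.smulLeftCLM ℂ (sobolevWeight m (-1)) χ) with hφ
  let e : Fin m → Eucl m := fun i => EuclideanSpace.single i 1
  have hF : ∀ i ξ, ‖𝓕 (∂_{e i} φ) ξ‖ ^ 2 =
      (2 * Real.pi) ^ 2 * ‖ξ i‖ ^ 2 * ((1 + ‖(2 * Real.pi) • ξ‖ ^ 2)⁻¹ * ‖χ ξ‖ ^ 2) := by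
    intro i ξ
    have ht : (fun x : Eucl m => inner ℝ x (e i)).HasTemperateGrowth := by fun_prop
    rw [SchwartzMap.fourier_lineDerivOp_eq, hφ, FourierTransform.fourier_fourierInv_eq,
      smul_apply, SchwartzMap.smulLeftCLM_apply_apply ht,
      SchwartzMap.smulLeftCLM_apply_apply (sobolevWeight_hasTemperateGrowth m (-1)),
      norm_smul, norm_smul, norm_smul, norm_sobolevWeight, mul_pow, mul_pow, mul_pow]
    have h1 : ‖(2 * Real.pi * Complex.I : ℂ)‖ = 2 * Real.pi := by
      simp [Real.pi_pos.le]
    have h2 : inner ℝ ξ (e i) = ξ i := by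
      simp [e, EuclideanSpace.inner_single_right]
    have h3 : ((1 + ‖(2 * Real.pi) • ξ‖ ^ 2) ^ (-1 / 2 : ℝ)) ^ 2 =
        (1 + ‖(2 * Real.pi) • ξ‖ ^ 2)⁻¹ := by
      rw [← Real.rpow_natCast, ← Real.rpow_mul (by positivity), ← Real.rpow_neg_one]
      norm_num
    rw [h1, h2, h3]
    ring
  have hsum : ∀ ξ, ∑ i, ‖𝓕 (∂_{e i} φ) ξ‖ ^ 2 ≤ ‖χ ξ‖ ^ 2 := by
    intro ξ
    simp_rw [hF]
    rw [← Finset.sum_mul, ← Finset.mul_sum, ← EuclideanSpace.norm_sq_eq, ← mul_assoc]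
    refine mul_le_of_le_one_left (by positivity) ?_
    rw [← div_eq_mul_inv, div_le_one (by positivity), norm_smul,
      Real.norm_of_nonneg (by positivity), mul_pow]
    linarith
  calc ∫⁻ x, ‖fderiv ℝ φ x‖ₑ ^ 2
      ≤ ∫⁻ x, ENNReal.ofReal (∑ i, ‖(∂_{e i} φ) x‖ ^ 2) := by
        refine lintegral_mono fun x => ?_
        rw [← ofReal_norm, ← ENNReal.ofReal_pow (norm_nonneg _)]
        refine ENNReal.ofReal_le_ofReal ((norm_clm_sq_le_sum _).trans (le_of_eq ?_))
        simp only [SchwartzMap.lineDerivOp_apply_eq_fderiv, e]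
    _ = ENNReal.ofReal (∫ x, ∑ i, ‖(∂_{e i} φ) x‖ ^ 2) := by
        rw [ofReal_integral_eq_lintegral_ofReal
          (integrable_finsetSum _ fun i _ => integrable_norm_sq _)
          (Eventually.of_forall fun x => Finset.sum_nonneg fun i _ => by positivity)]
    _ = ENNReal.ofReal (∫ ξ, ∑ i, ‖𝓕 (∂_{e i} φ) ξ‖ ^ 2) := by
        rw [integral_finsetSum _ fun i _ => integrable_norm_sq _,
          integral_finsetSum _ fun i _ => integrable_norm_sq _]
        simp_rw [SchwartzMap.integral_norm_sq_fourier]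
    _ ≤ ENNReal.ofReal (∫ ξ, ‖χ ξ‖ ^ 2) := by
        refine ENNReal.ofReal_le_ofReal (integral_mono
          (integrable_finsetSum _ fun i _ => integrable_norm_sq _) (integrable_norm_sq _) hsum)
    _ = _ := (enorm_toLp_sq χ).symm

/-! ### Piecewise constant functions -/

namespace PreConvexMesh

variable {m : ℕ} {Ω : Set (Eucl m)} (M : PreConvexMesh Ω)

theorem volume_T_ne_top (hΩ : Bornology.IsBounded Ω) (l : Fin M.N) : volume (M.T l) ≠ ∞ :=
  (hΩ.subset (M.T_subset l)).measure_lt_top.ne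

/-- The indicator function of an element of the mesh. -/
def indicatorL2 (hΩ : Bornology.IsBounded Ω) (l : Fin M.N) : Lp ℂ 2 (volume : Measure (Eucl m)) :=
  indicatorConstLp 2 (M.isOpen_T l).measurableSet (M.volume_T_ne_top hΩ l) 1

theorem coeFn_indicatorL2 (hΩ : Bornology.IsBounded Ω) :
    ∀ᵐ x, ∀ l, M.indicatorL2 hΩ l x = (M.T l).indicator (fun _ => 1) x :=
  ae_all_iff.2 fun _ => indicatorConstLp_coeFn

theorem notMem_T_of_mem {l l' : Fin M.N} (h : l ≠ l') {x : Eucl m} (hx : x ∈ M.T l) :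
    x ∉ M.T l' := fun hx' =>
  Set.disjoint_left.1 (M.disjoint_convexHull l l' h) (subset_convexHull ℝ _ hx)
    (subset_convexHull ℝ _ hx')

theorem ae_exists_mem_T : ∀ᵐ x, x ∈ Ω → ∃ l, x ∈ M.T l := by
  have h : ∀ᵐ x, ∀ l, x ∉ frontier (M.T l) :=
    ae_all_iff.2 fun l => measure_eq_zero_iff_ae_notMem.1 (M.volume_frontier l)
  filter_upwards [h] with x hx hxΩ
  rw [M.eq_interior] at hxΩ
  obtain ⟨l, hl⟩ := Set.mem_iUnion.1 (interior_subset hxΩ)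
  refine ⟨l, ?_⟩
  by_contra hxT
  refine hx l ?_
  rw [(M.isOpen_T l).frontier_eq]
  exact ⟨hl, hxT⟩

/-- The piecewise constant functions in `L²`, as the span of the indicator functions of the
elements. -/
def pieces (hΩ : Bornology.IsBounded Ω) : Submodule ℂ (Lp ℂ 2 (volume : Measure (Eucl m))) :=
  Submodule.span ℂ (Set.range (M.indicatorL2 hΩ))

instance (hΩ : Bornology.IsBounded Ω) : FiniteDimensional ℂ (M.pieces hΩ) :=
  FiniteDimensional.span_of_finite ℂ (Set.finite_range _)

theorem mem_pieces (hΩ : Bornology.IsBounded Ω)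
    {f : Lp ℂ 2 (volume : Measure (Eucl m))} (hf : ∀ᵐ x, x ∉ Ω → f x = 0)
    (hfc : ∀ l, ∃ c : ℂ, ∀ᵐ x, x ∈ M.T l → f x = c) : f ∈ M.pieces hΩ := by
  choose c hc using hfc
  have h : f = ∑ l, c l • M.indicatorL2 hΩ l := by
    ext1
    filter_upwards [hf, ae_all_iff.2 hc, M.ae_exists_mem_T, M.coeFn_indicatorL2 hΩ,
      Lp.coeFn_fun_finsetSum Finset.univ (fun l => c l • M.indicatorL2 hΩ l),
      ae_all_iff.2 fun l => Lp.coeFn_smul (c l) (M.indicatorL2 hΩ l)] with x h1 h2 h3 h4 h5 h6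
    rw [h5]
    simp only [h6, Pi.smul_apply, h4, smul_eq_mul]
    by_cases hx : x ∈ Ω
    · obtain ⟨l, hl⟩ := h3 hx
      rw [Finset.sum_eq_single l, Set.indicator_of_mem hl, mul_one, h2 l hl]
      · intro l' _ hl'
        rw [Set.indicator_of_notMem (M.notMem_T_of_mem hl'.symm hl), mul_zero]
      · exact fun h => absurd (Finset.mem_univ l) h
    · rw [h1 hx, Finset.sum_eq_zero]
      intro l _
      rw [Set.indicator_of_notMem fun h => hx (M.T_subset l h), mul_zero]
  rw [h]
  exact Submodule.sum_mem _ fun l _ =>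
    Submodule.smul_mem _ _ (Submodule.subset_span ⟨l, rfl⟩)

theorem piecewiseConst_eq_map (hΩ : Bornology.IsBounded Ω) {s : ℝ} (hs : s ≤ 0) :
    M.piecewiseConst s = (M.pieces hΩ).map (Sobolev.ofL2 m hs) := by
  apply le_antisymm
  · rintro u ⟨f, hf, hf0, hfc⟩
    refine ⟨f, M.mem_pieces hΩ hf0 hfc, Sobolev.toDistr_injective m s ?_⟩
    rw [Sobolev.toDistr_ofL2, hf]
  · rw [Submodule.map_le_iff_le_comap, pieces, Submodule.span_le]
    rintro _ ⟨l, rfl⟩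
    refine ⟨M.indicatorL2 hΩ l, Sobolev.toDistr_ofL2 hs _, ?_, fun l' => ?_⟩
    · filter_upwards [M.coeFn_indicatorL2 hΩ] with x hx hxΩ
      rw [hx, Set.indicator_of_notMem fun h => hxΩ (M.T_subset l h)]
    · by_cases h : l' = l
      · refine ⟨1, ?_⟩
        filter_upwards [M.coeFn_indicatorL2 hΩ] with x hx hxT
        rw [hx, Set.indicator_of_mem (h ▸ hxT)]
      · refine ⟨0, ?_⟩
        filter_upwards [M.coeFn_indicatorL2 hΩ] with x hx hxT
        rw [hx, Set.indicator_of_notMem (M.notMem_T_of_mem h hxT)]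

theorem ae_eq_zero_of_mem_pieces (hΩ : Bornology.IsBounded Ω)
    {f : Lp ℂ 2 (volume : Measure (Eucl m))}
    (hf : f ∈ M.pieces hΩ) : ∀ᵐ x, x ∉ Ω → f x = 0 := by
  -- The definition of `piecewiseConst` contains the claim, so pass through `H⁰`.
  have h : Sobolev.ofL2 m le_rfl f ∈ M.piecewiseConst 0 := by
    rw [M.piecewiseConst_eq_map hΩ le_rfl]
    exact ⟨f, hf, rfl⟩
  obtain ⟨g, hg, hg0, -⟩ := h
  rw [Sobolev.toDistr_ofL2] at hg
  rwa [toTemperedDistribution_injective m hg]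

theorem isClosed_piecewiseConst (hΩ : Bornology.IsBounded Ω) {s : ℝ} (hs : s ≤ 0) :
    IsClosed (M.piecewiseConst s : Set (Sobolev m s)) := by
  rw [M.piecewiseConst_eq_map hΩ hs]
  exact Submodule.closed_of_finiteDimensional _

theorem diam_T_le_meshSize (l : Fin M.N) : Metric.diam (M.T l) ≤ M.meshSize :=
  le_ciSup (Set.finite_range fun l => Metric.diam (M.T l)).bddAbove l

theorem meshSize_nonneg : 0 ≤ M.meshSize :=
  Real.iSup_nonneg fun _ => Metric.diam_nonneg

theorem edist_le_of_mem_convexHull (hΩ : Bornology.IsBounded Ω) (l : Fin M.N) {x y : Eucl m}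
    (hx : x ∈ convexHull ℝ (M.T l))
    (hy : y ∈ convexHull ℝ (M.T l)) : edist x y ≤ ENNReal.ofReal M.meshSize := by
  rw [edist_dist]
  refine ENNReal.ofReal_le_ofReal ?_
  refine (Metric.dist_le_diam_of_mem
    (isBounded_convexHull.2 (hΩ.subset (M.T_subset l))) hx hy).trans ?_
  rw [convexHull_diam]
  exact M.diam_T_le_meshSize l

/-- The Poincaré inequality on the convex hulls of the elements. The hulls are disjoint, so that
the bounds for the elements add up. -/
theorem exists_sum_setLIntegral_le (hΩ : Bornology.IsBounded Ω)
    {φ : Eucl m → ℂ} (hφ : ContDiff ℝ 1 φ) :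
    ∃ c : Fin M.N → ℂ, ∑ l, ∫⁻ x in M.T l, ‖φ x - c l‖ₑ ^ 2 ≤
      ENNReal.ofReal M.meshSize ^ 2 * (2 ^ m * ∫⁻ x, ‖fderiv ℝ φ x‖ₑ ^ 2) := by
  have h : ∀ l, ∃ y, ∫⁻ x in convexHull ℝ (M.T l), ‖φ x - φ y‖ₑ ^ 2 ≤
      ENNReal.ofReal M.meshSize ^ 2 *
        (2 ^ m * ∫⁻ x in convexHull ℝ (M.T l), ‖fderiv ℝ φ x‖ₑ ^ 2) := fun l =>
    exists_setLIntegral_enorm_sub_sq_le (convex_convexHull ℝ _) (M.isOpen_T l).convexHull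
      (M.nonempty_T l).convexHull (isBounded_convexHull.2 (hΩ.subset (M.T_subset l))) hφ
      fun x hx y hy => M.edist_le_of_mem_convexHull hΩ l hx hy
  choose y hy using h
  refine ⟨fun l => φ (y l), ?_⟩
  calc ∑ l, ∫⁻ x in M.T l, ‖φ x - φ (y l)‖ₑ ^ 2
      ≤ ∑ l, ENNReal.ofReal M.meshSize ^ 2 *
        (2 ^ m * ∫⁻ x in convexHull ℝ (M.T l), ‖fderiv ℝ φ x‖ₑ ^ 2) :=
        Finset.sum_le_sum fun l _ =>
          (lintegral_mono_set (subset_convexHull ℝ _)).trans (hy l)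
    _ = ENNReal.ofReal M.meshSize ^ 2 *
        (2 ^ m * ∫⁻ x in ⋃ l, convexHull ℝ (M.T l), ‖fderiv ℝ φ x‖ₑ ^ 2) := by
        rw [lintegral_iUnion (fun l => (M.isOpen_T l).convexHull.measurableSet)
          (fun l l' h => M.disjoint_convexHull l l' h), tsum_fintype, Finset.mul_sum,
          Finset.mul_sum]
    _ ≤ _ := by
        exact mul_le_mul' le_rfl (mul_le_mul' le_rfl (setLIntegral_le_lintegral _ _))

/-- The pairing of a function orthogonal to the piecewise constants with a smooth function gains
a factor of the mesh size. -/
theorem enorm_inner_le (hΩ : Bornology.IsBounded Ω)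
    {g : Lp ℂ 2 (volume : Measure (Eucl m))} (hg : g ∈ (M.pieces hΩ)ᗮ)
    (hg0 : ∀ᵐ x, x ∉ Ω → g x = 0) (φ : 𝓢(Eucl m, ℂ)) :
    ‖(inner ℂ g (φ.toLp 2) : ℂ)‖ₑ ^ 2 ≤ ‖g‖ₑ ^ 2 *
      (ENNReal.ofReal M.meshSize ^ 2 * (2 ^ m * ∫⁻ x, ‖fderiv ℝ φ x‖ₑ ^ 2)) := by
  obtain ⟨c, hc⟩ := M.exists_sum_setLIntegral_le hΩ (φ.smooth 1)
  have hΩm : MeasurableSet Ω := by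
    rw [M.eq_interior]
    exact isOpen_interior.measurableSet
  have hφΩ : MemLp (Ω.indicator φ) 2 volume := (φ.memLp 2).indicator hΩm
  set p : Lp ℂ 2 (volume : Measure (Eucl m)) := ∑ l, c l • M.indicatorL2 hΩ l with hp
  have hpm : p ∈ M.pieces hΩ := Submodule.sum_mem _ fun l _ =>
    Submodule.smul_mem _ _ (Submodule.subset_span ⟨l, rfl⟩)
  -- `g` is orthogonal to `p` and vanishes off `Ω`, so it does not see the difference between `φ`
  -- and `q`.
  set q : Lp ℂ 2 (volume : Measure (Eucl m)) := hφΩ.toLp _ - p with hq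
  have h1 : (inner ℂ g (φ.toLp 2) : ℂ) = inner ℂ g q := by
    rw [hq, inner_sub_right, Submodule.inner_left_of_mem_orthogonal hpm hg, sub_zero,
      L2.inner_def, L2.inner_def]
    refine integral_congr_ae ?_
    filter_upwards [hg0, φ.coeFn_toLp 2, hφΩ.coeFn_toLp] with x h2 h3 h4
    rw [h3, h4]
    by_cases hx : x ∈ Ω
    · rw [Set.indicator_of_mem hx]
    · rw [h2 hx, inner_zero_left, inner_zero_left]
  have h2 : ‖q‖ₑ ^ 2 ≤ ∑ l, ∫⁻ x in M.T l, ‖φ x - c l‖ₑ ^ 2 := by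
    have h3 : ‖q‖ₑ ^ 2 = ∫⁻ x, ‖q x‖ₑ ^ 2 := by
      have := eLpNorm_nnreal_pow_eq_lintegral (f := q) (μ := volume) (p := 2) two_ne_zero
      simp only [NNReal.coe_ofNat, ENNReal.coe_ofNat, ENNReal.rpow_ofNat] at this
      rw [Lp.enorm_def, this]
    rw [h3]
    have h4 : ∀ l, ∫⁻ x in M.T l, ‖φ x - c l‖ₑ ^ 2 =
        ∫⁻ x, (M.T l).indicator (fun x => ‖φ x - c l‖ₑ ^ 2) x := fun l =>
      (lintegral_indicator (M.isOpen_T l).measurableSet _).symm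
    simp_rw [h4]
    rw [← lintegral_finsetSum]
    · refine lintegral_mono_ae ?_
      filter_upwards [Lp.coeFn_sub (hφΩ.toLp _) p, hφΩ.coeFn_toLp, M.ae_exists_mem_T,
        M.coeFn_indicatorL2 hΩ,
        Lp.coeFn_fun_finsetSum Finset.univ (fun l => c l • M.indicatorL2 hΩ l),
        ae_all_iff.2 fun l => Lp.coeFn_smul (c l) (M.indicatorL2 hΩ l)] with x h5 h6 h7 h8 h9 h10
      rw [hq, h5, Pi.sub_apply, h6, hp, h9]
      simp only [h10, Pi.smul_apply, h8, smul_eq_mul]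
      by_cases hx : x ∈ Ω
      · obtain ⟨l, hl⟩ := h7 hx
        refine le_trans (le_of_eq ?_) (Finset.single_le_sum (fun _ _ => zero_le)
          (Finset.mem_univ l))
        rw [Set.indicator_of_mem hx, Set.indicator_of_mem hl, Finset.sum_eq_single l,
          Set.indicator_of_mem hl, mul_one]
        · intro l' _ hl'
          rw [Set.indicator_of_notMem (M.notMem_T_of_mem hl'.symm hl), mul_zero]
        · exact fun h => absurd (Finset.mem_univ l) h
      · rw [Set.indicator_of_notMem hx, Finset.sum_eq_zero]
        · simp
        · intro l _
          rw [Set.indicator_of_notMem fun h => hx (M.T_subset l h), mul_zero]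
    · intro l _
      refine Measurable.indicator ?_ (M.isOpen_T l).measurableSet
      exact ((ENNReal.continuous_pow 2).comp
        (φ.continuous.sub continuous_const).enorm).measurable
  have h5 : ‖(inner ℂ g q : ℂ)‖ₑ ≤ ‖g‖ₑ * ‖q‖ₑ := by
    rw [← ofReal_norm, ← ofReal_norm, ← ofReal_norm,
      ← ENNReal.ofReal_mul (norm_nonneg _)]
    exact ENNReal.ofReal_le_ofReal (norm_inner_le_norm _ _)
  rw [h1]
  calc _ ≤ (‖g‖ₑ * ‖q‖ₑ) ^ 2 := by gcongr
    _ = ‖g‖ₑ ^ 2 * ‖q‖ₑ ^ 2 := mul_pow _ _ _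
    _ ≤ _ := by
      gcongr
      exact h2.trans hc

/-- The duality estimate: the operator with symbol `(1 + |2πξ|²)^(-1/2)` turns `ψ` into a function
with gradient in `L²`, on which `g` gains a factor of the mesh size. By density it suffices to take
`ψ` in the Schwartz space. -/
theorem norm_inner_weight_le (hΩ : Bornology.IsBounded Ω) {g : Lp ℂ 2 (volume : Measure (Eucl m))}
    (hg : g ∈ (M.pieces hΩ)ᗮ) (hg0 : ∀ᵐ x, x ∉ Ω → g x = 0)
    (ψ : Lp ℂ 2 (volume : Measure (Eucl m))) :
    ‖(inner ℂ (𝓕 g) (l2Mul (boundedWeight m (neg_nonpos.2 zero_le_one)) ψ) : ℂ)‖ ≤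
      √(2 ^ m) * M.meshSize * ‖g‖ * ‖ψ‖ := by
  have hcont : Continuous (l2Mul (boundedWeight m (neg_nonpos.2 (zero_le_one' ℝ)))) :=
    AddMonoidHomClass.continuous_of_bound _ 1
      (norm_l2Mul_le _ (norm_sobolevWeight_le_one (neg_nonpos.2 zero_le_one)))
  refine DenseRange.induction_on (SchwartzMap.denseRange_toLpCLM (F := ℂ) (E := Eucl m)
    (μ := volume) (p := 2) ENNReal.ofNat_ne_top) ψ ?_ fun χ => ?_
  · exact isClosed_le (continuous_const.inner hcont).norm (continuous_const.mul continuous_norm)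
  · rw [SchwartzMap.toLpCLM_apply]
    set φ : 𝓢(Eucl m, ℂ) := 𝓕⁻ (SchwartzMap.smulLeftCLM ℂ (sobolevWeight m (-1)) χ) with hφ
    have h1 : l2Mul (boundedWeight m (neg_nonpos.2 zero_le_one)) (χ.toLp 2) =
        𝓕 (φ.toLp 2) := by
      rw [SchwartzMap.toLp_fourier_eq, hφ, FourierTransform.fourier_fourierInv_eq]
      ext1
      filter_upwards [coeFn_l2Mul (boundedWeight m (neg_nonpos.2 (zero_le_one' ℝ))) (χ.toLp 2),
        χ.coeFn_toLp 2,
        (SchwartzMap.smulLeftCLM ℂ (sobolevWeight m (-1)) χ).coeFn_toLp 2] with x h2 h3 h4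
      rw [h2, h3, h4, boundedWeight_apply, SchwartzMap.smulLeftCLM_apply_apply
        (sobolevWeight_hasTemperateGrowth m (-1)), smul_eq_mul]
    rw [h1, Lp.inner_fourier_eq]
    have h2 := (M.enorm_inner_le hΩ hg hg0 φ).trans
      (mul_le_mul' le_rfl (mul_le_mul' le_rfl (mul_le_mul' le_rfl (lintegral_fderiv_sq_le χ))))
    have h3 : ‖(inner ℂ g (φ.toLp 2) : ℂ)‖ ^ 2 ≤
        (√(2 ^ m) * M.meshSize * ‖g‖ * ‖χ.toLp 2‖) ^ 2 := by
      rw [mul_pow, mul_pow, mul_pow, Real.sq_sqrt (by positivity)]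
      rw [← ENNReal.ofReal_le_ofReal_iff (by positivity)]
      have hM := M.meshSize_nonneg
      rw [ENNReal.ofReal_mul (by positivity), ENNReal.ofReal_mul (by positivity),
        ENNReal.ofReal_mul (by positivity), ENNReal.ofReal_pow (by positivity),
        ENNReal.ofReal_pow (by positivity), ENNReal.ofReal_pow (by positivity),
        ENNReal.ofReal_pow (by positivity), ENNReal.ofReal_pow (by positivity),
        ENNReal.ofReal_ofNat, ofReal_norm, ofReal_norm, ofReal_norm]
      refine h2.trans (le_of_eq ?_)
      ring
    have hM := M.meshSize_nonneg
    exact (pow_le_pow_iff_left₀ (norm_nonneg _) (by positivity) two_ne_zero).1 h3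

/-- The norm of `H^(-1/2)` is the quadratic form of the operator with symbol
`(1 + |2πξ|²)^(-1/2)`. -/
theorem norm_ofL2_sq {g : Lp ℂ 2 (volume : Measure (Eucl m))} (hs : (-1 / 2 : ℝ) ≤ 0) :
    ‖Sobolev.ofL2 m hs g‖ ^ 2 = ‖(inner ℂ (𝓕 g)
      (l2Mul (boundedWeight m (neg_nonpos.2 (zero_le_one' ℝ))) (𝓕 g)) : ℂ)‖ := by
  rw [Sobolev.norm_eq, Sobolev.symbol_ofL2]
  have h1 : (inner ℂ (𝓕 g) (l2Mul (boundedWeight m (neg_nonpos.2 (zero_le_one' ℝ))) (𝓕 g)) : ℂ) =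
      inner ℂ (l2Mul (boundedWeight m hs) (𝓕 g)) (l2Mul (boundedWeight m hs) (𝓕 g)) := by
    rw [L2.inner_def, L2.inner_def]
    refine integral_congr_ae ?_
    filter_upwards [coeFn_l2Mul (boundedWeight m (neg_nonpos.2 (zero_le_one' ℝ))) (𝓕 g),
      coeFn_l2Mul (boundedWeight m hs) (𝓕 g)] with x h2 h3
    rw [h2, h3, boundedWeight_apply, boundedWeight_apply]
    have h4 : sobolevWeight m (-1) x = sobolevWeight m (-1 / 2) x * sobolevWeight m (-1 / 2) x := by
      rw [sobolevWeight, sobolevWeight, ← Complex.ofReal_mul, ← Real.rpow_add (by positivity)]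
      norm_num
    have h5 : (starRingEnd ℂ) (sobolevWeight m (-1 / 2) x) = sobolevWeight m (-1 / 2) x :=
      Complex.conj_ofReal _
    simp only [RCLike.inner_apply, map_mul, h4, h5]
    ring
  rw [h1, inner_self_eq_norm_sq_to_K, norm_pow]
  simp

/-- Approximation in `H^(-1/2)` by piecewise constants, of order one half in the mesh size. The
approximant is the orthogonal projection in `L²`. -/
theorem exists_mem_piecewiseConst_norm_sub_sq_le (hΩ : Bornology.IsBounded Ω)
    (hs : (-1 / 2 : ℝ) ≤ 0)
    {f : Lp ℂ 2 (volume : Measure (Eucl m))} (hf : ∀ᵐ x, x ∉ Ω → f x = 0) :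
    ∃ u ∈ M.piecewiseConst (-1 / 2), ‖Sobolev.ofL2 m hs f - u‖ ^ 2 ≤
      √(2 ^ m) * M.meshSize * ‖f‖ ^ 2 := by
  set P := (M.pieces hΩ).starProjection f with hP
  have hPm : P ∈ M.pieces hΩ := Submodule.starProjection_apply_mem _ _
  have hg : f - P ∈ (M.pieces hΩ)ᗮ := Submodule.sub_starProjection_mem_orthogonal _
  have hg0 : ∀ᵐ x, x ∉ Ω → (f - P : Lp ℂ 2 (volume : Measure (Eucl m))) x = 0 := by
    filter_upwards [hf, M.ae_eq_zero_of_mem_pieces hΩ hPm, Lp.coeFn_sub f P] with x h1 h2 h3 hx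
    rw [h3, Pi.sub_apply, h1 hx, h2 hx, sub_zero]
  have hnorm : ‖f - P‖ ≤ ‖f‖ := by
    have h1 : ‖f‖ * ‖f‖ = ‖f - P‖ * ‖f - P‖ + ‖P‖ * ‖P‖ := by
      have h2 := norm_add_sq_eq_norm_sq_add_norm_sq_of_inner_eq_zero (f - P) P
        (Submodule.inner_left_of_mem_orthogonal hPm hg)
      rwa [sub_add_cancel] at h2
    nlinarith [norm_nonneg f, norm_nonneg (f - P), norm_nonneg P]
  refine ⟨Sobolev.ofL2 m hs P, ?_, ?_⟩
  · rw [M.piecewiseConst_eq_map hΩ hs]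
    exact ⟨P, hPm, rfl⟩
  · rw [← map_sub, norm_ofL2_sq]
    refine (M.norm_inner_weight_le hΩ hg hg0 _).trans ?_
    have hM := M.meshSize_nonneg
    rw [Lp.norm_fourier_eq, mul_assoc _ ‖f - P‖, ← sq]
    gcongr

end PreConvexMesh

end ScreenBEM

end

noncomputable section

namespace ScreenBEM

/-! ### Mosco convergence -/

/-- To be approximated by a sequence of subsets is a closed condition. -/
theorem tendsto_infDist_of_mem_closure {H : Type*} [PseudoMetricSpace H] {W : ℕ → Set H}
    {D : Set H} (hD : ∀ v ∈ D, Tendsto (fun j => Metric.infDist v (W j)) atTop (𝓝 0)) {v : H}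
    (hv : v ∈ closure D) : Tendsto (fun j => Metric.infDist v (W j)) atTop (𝓝 0) := by
  rw [Metric.tendsto_atTop]
  intro ε hε
  obtain ⟨u, hu, hvu⟩ := Metric.mem_closure_iff.1 hv (ε / 2) (half_pos hε)
  obtain ⟨N, hN⟩ := Metric.tendsto_atTop.1 (hD u hu) (ε / 2) (half_pos hε)
  refine ⟨N, fun j hj => ?_⟩
  have h1 := hN j hj
  rw [Real.dist_0_eq_abs, abs_of_nonneg Metric.infDist_nonneg] at h1 ⊢
  linarith [Metric.infDist_le_infDist_add_dist (s := W j) (x := v) (y := u)]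

theorem exists_tendsto_of_tendsto_infDist {H : Type*} [SeminormedAddCommGroup H]
    {W : ℕ → Set H} (hW : ∀ j, (W j).Nonempty) {v : H}
    (hv : Tendsto (fun j => Metric.infDist v (W j)) atTop (𝓝 0)) :
    ∃ w : ℕ → H, (∀ j, w j ∈ W j) ∧ Tendsto (fun j => ‖w j - v‖) atTop (𝓝 0) := by
  have h : ∀ j : ℕ, ∃ u ∈ W j, dist v u < Metric.infDist v (W j) + 1 / ((j : ℝ) + 1) := fun j =>
    (Metric.infDist_lt_iff (hW j)).1 (lt_add_of_pos_right _ Nat.one_div_pos_of_nat)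
  choose w hw hwv using h
  have hlim := hv.add (tendsto_one_div_add_atTop_nhds_zero_nat (𝕜 := ℝ))
  rw [add_zero] at hlim
  refine ⟨w, hw, squeeze_zero (fun _ => norm_nonneg _) (fun j => ?_) hlim⟩
  rw [← dist_eq_norm, dist_comm]
  exact (hwv j).le

/-- Mollification at scale `ε j` followed by projection onto the piecewise constants approximates
every element of `H^(-1/2)_Γ` that belongs to `Hᵗ_Γ`. -/
theorem tendsto_infDist_piecewiseConst {m : ℕ} {Γ : Set (Eucl m)} (hΓ : IsClosed Γ)
    {Ω : ℕ → Set (Eucl m)} (hbdd : ∀ j, Bornology.IsBounded (Ω j)) {ε : ℕ → ℝ}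
    (hε : ∀ j, 0 < ε j) (h0 : Tendsto ε atTop (𝓝 0))
    (hinner : ∀ j, Metric.thickening (ε j) Γ ⊆ Ω j) (M : ∀ j, PreConvexMesh (Ω j)) {t : ℝ}
    (ht : t ∈ Set.Icc (-1 / 2 : ℝ) 0)
    (hh : (fun j => (M j).meshSize) =o[atTop] fun j => ε j ^ (-2 * t))
    {v : Sobolev m (-1 / 2)} {w : Sobolev m t} (hw : w ∈ supportedIn m t Γ)
    (hvw : Sobolev.toDistr m t w = Sobolev.toDistr m (-1 / 2) v) :
    Tendsto (fun j => Metric.infDist v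
      ((M j).piecewiseConst (-1 / 2) : Set (Sobolev m (-1 / 2)))) atTop (𝓝 0) := by
  have hs : (-1 / 2 : ℝ) ≤ 0 := by norm_num
  obtain ⟨μ, hμ⟩ := exists_isMollifierSymbol m
  obtain ⟨C, hC⟩ := exists_norm_mollify_le ht μ w
  have hconv : Tendsto (fun j => ‖v - Sobolev.ofL2 m hs (mollify μ (hε j) w)‖) atTop (𝓝 0) := by
    have h1 := tendsto_iff_norm_sub_tendsto_zero.1
      (hμ.tendsto_l2Mul hε h0 (Sobolev.symbol m (-1 / 2) v))
    refine h1.congr fun j => ?_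
    rw [norm_sub_rev, Sobolev.norm_eq, map_sub, symbol_ofL2_mollify hs μ (hε j) hvw]
  -- The square of the projection error is of order `h ε^(2t)`, and `h = o(ε^(-2t))`.
  have hmesh : Tendsto (fun j => √(√(2 ^ m) * (M j).meshSize * (C * ε j ^ t) ^ 2)) atTop
      (𝓝 0) := by
    have h2 := ((hh.tendsto_div_nhds_zero).const_mul (√(2 ^ m) * C ^ 2)).sqrt
    rw [mul_zero, Real.sqrt_zero] at h2
    refine h2.congr fun j => congrArg _ ?_
    have h3 : (ε j ^ t) ^ 2 = (ε j ^ (-2 * t))⁻¹ := by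
      rw [← Real.rpow_natCast, ← Real.rpow_mul (hε j).le, ← Real.rpow_neg (hε j).le]
      congr 1
      push_cast
      ring
    rw [mul_pow, h3, div_eq_mul_inv]
    ring
  refine squeeze_zero' (Eventually.of_forall fun j => Metric.infDist_nonneg) ?_
    (by simpa using hconv.add hmesh)
  filter_upwards [h0.eventually_le_const one_pos] with j hj
  have hzero : ∀ᵐ x, x ∉ Ω j → mollify μ (hε j) w x = 0 := by
    filter_upwards [hμ.mollify_ae_eq_zero (hε j) hΓ hw] with x hx hxΩ
    exact hx fun h => hxΩ (hinner j h)
  obtain ⟨u, hu, hle⟩ :=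
    (M j).exists_mem_piecewiseConst_norm_sub_sq_le (hbdd j) hs hzero
  have h4 : ‖Sobolev.ofL2 m hs (mollify μ (hε j) w) - u‖ ≤
      √(√(2 ^ m) * (M j).meshSize * (C * ε j ^ t) ^ 2) := by
    refine Real.le_sqrt_of_sq_le (hle.trans ?_)
    have hM := (M j).meshSize_nonneg
    gcongr
    exact hC _ (hε j) hj
  calc Metric.infDist v _ ≤ dist v u := Metric.infDist_le_dist_of_mem hu
    _ ≤ ‖v - Sobolev.ofL2 m hs (mollify μ (hε j) w)‖ +
        ‖Sobolev.ofL2 m hs (mollify μ (hε j) w) - u‖ := by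
      rw [dist_eq_norm]
      exact norm_sub_le_norm_sub_add_norm_sub _ _ _
    _ ≤ _ := by gcongr

end ScreenBEM

end

theorem theorem4p4 (m : ℕ) (hm : 1 ≤ m)
    (Γ : Set (Eucl m)) (hΓne : Γ.Nonempty) (hΓ : IsCompact Γ)
    (Γseq : ℕ → Set (Eucl m)) (hopen : ∀ j, IsOpen (Γseq j))
    (hbdd : ∀ j, Bornology.IsBounded (Γseq j))
    (ε η : ℕ → ℝ) (hε : ∀ j, 0 < ε j) (hεη : ∀ j, ε j < η j)
    (hη : Tendsto η atTop (𝓝 0))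
    (hinner : ∀ j, Metric.thickening (ε j) Γ ⊆ Γseq j)
    (houter : ∀ j, Γseq j ⊆ Metric.thickening (η j) Γ)
    (M : ∀ j, PreConvexMesh (Γseq j)) :
    SupportedDense m (-1 / 2) (-1 / 2) Γ ∧
    ∀ t ∈ Set.Icc (-1 / 2 : ℝ) 0,
      SupportedDense m t (-1 / 2) Γ →
      (fun j => (M j).meshSize) =o[atTop] (fun j => ε j ^ (-2 * t)) →
      MoscoConverges (fun j => (M j).piecewiseConst (-1 / 2)) (supportedIn m (-1 / 2) Γ) := by
  refine ⟨fun u hu => subset_closure ⟨u, hu, rfl⟩, fun t ht hdense hh => ?_⟩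
  refine ⟨fun j => (M j).isClosed_piecewiseConst (hbdd j) (by norm_num),
    isClosed_supportedIn _ hΓ.isClosed, fun v hv => ?_, fun k hk w hw v hv => ?_⟩
  · have h0 : Tendsto ε atTop (𝓝 0) :=
      squeeze_zero (fun j => (hε j).le) (fun j => (hεη j).le) hη
    refine exists_tendsto_of_tendsto_infDist (fun j => ⟨0, Submodule.zero_mem _⟩)
      (tendsto_infDist_of_mem_closure ?_ (hdense v hv))
    rintro u ⟨w, hw, hwu⟩
    exact tendsto_infDist_piecewiseConst hΓ.isClosed hbdd hε h0 hinner M ht hh hw hwu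
  · exact mem_supportedIn_of_weak_limit hΓ (hη.comp hk.tendsto_atTop) (fun i => houter (k i))
      (fun i => M (k i)) hw hv
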